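/- **Setting.** Let $m\ge 1$, $N\ge 2$, let $e_1,\dots,e_N\in\mathbb R^m$ be nonzero vectors pointing in pairwise different directions (no $e_i$ is a positive multiple of $e_j$ for $i\ne j$), let $O=0$, $J_j=(0,1)e_j$ and $\overline{\mathcal G}=\bigcup_{j}[0,1]e_j$. Let $A$ be a compact metric space (for instance a compact subset of $\mathbb R^d$), $E$ a finite set, $\delta>0$, and for each $j$ let $E=E_j^{active}\sqcup E_j^{inactive}$ be a partition. Let $f_\gamma:\mathbb R^m\times A\to\mathbb R^m$ and $l_\gamma:\mathbb R^m\times A\to\mathbb R$ ($\gamma\in E$) be uniformly continuous, and suppose that there is $C>0$ such that for all $\gamma\in E$, $x,y\in\mathbb R^m$, $a\in A$ $$\langle f_\gamma(x,a)-f_\gamma(y,a),x-y\rangle\le C|x-y|^2,\quad |f_\gamma(x,a)|\le C,\quad |l_\gamma(x,a)-l_\gamma(y,a)|\le C|x-y|,\quad |l_\gamma(x,a)|\le C.$$ For a Borel measurable $\alpha:\mathbb R_+\to A$ let $y_\gamma(\cdot\,;x,\alpha)$ be the solution of $y'(t)=f_\gamma(y(t),\alpha(t))$, $t\ge0$, $y(0)=x$.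 For $x\in\overline{\mathcal G}$ let $$\mathcal A_{\gamma,x}=\{\alpha:\mathbb R_+\to A\ \text{Borel}:\ y_\gamma(t;x,\alpha)\in\overline{\mathcal G}\ \ \forall t\ge0\},\qquad A_{\gamma,x}=\{a\in A:\ \exists\theta>0\ \ \forall t\in[0,\theta]\ \ y_\gamma(t;x,a)\in\overline{\mathcal G}\}.$$ Assume that there are nonempty sets $A^{\gamma,j}\subset A$ such that for all $\gamma\in E$ and $1\le j\le N$: * **(Aa)** $A_{\gamma,x}=A^{\gamma,j}$ for $x\in J_j$; $A_{\gamma,O}=\bigcup_{i=1}^N\{a\in A^{\gamma,i}: f_\gamma(O,a)\in\mathbb R_+e_i\}$; $A_{\gamma,e_j}=\{a\in A^{\gamma,j}:\langle f_\gamma(e_j,a),e_j\rangle\le0\}\neq\emptyset$; and either $A_{\gamma,e_j}=A^{\gamma,j}$ or there are $\beta>0$ and $a\in A^{\gamma,j}$ with $\langle f_\gamma(e_j,a),e_j\rangle<-\beta$. * **(Ab)** If $\gamma\in E_j^{active}$, there are $\beta>0$ and $a^+,a^-\in A^{\gamma,j}$ with $\langle f_\gamma(O,a^+),e_j\rangle>\beta$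 and $\langle f_\gamma(O,a^-),e_j\rangle<-\beta$. If $\gamma\in E_j^{inactive}$, there are $\beta>0$, $0<\eta<1$, $\kappa\in[0,1)$ and $a^-,a^0\in A^{\gamma,j}$ such that $f_\gamma(O,a^0)=0$ and, for all $x\in J_j$ with $|x|\le\eta$, $\langle f_\gamma(x,a^-),e_j\rangle\le-\beta\langle x,e_j\rangle^\kappa$ and $\langle f_\gamma(x,a),e_j\rangle\le0$ for every $a\in A^{\gamma,j}$. * **(Ac)** If $\gamma\in E_j^{inactive}$, then $l_\gamma(O,a)$ is the same for all $a\in A^{\gamma,j}$. * **(Ad)** For every $x\in J_j$ there is $\theta>0$ such that every $\alpha\in\mathcal A_{\gamma,x}$ satisfies $\alpha(t)\in A^{\gamma,j}$ for almost all $t\in[0,\theta]$. **Theorem.** For every $\gamma\in E$ the deterministic value function $$v_0^\delta(x,\gamma)=\inf_{\alpha\in\mathcal A_{\gamma,x}}\int_0^\infty e^{-\delta t}\,l_\gamma\big(y_\gamma(t;x,\alpha),\alpha(t)\big)\,dt,\qquad x\in\overline{\mathcal G},$$ is well defined (the infimum is finite and is taken over a nonempty set), and $v_0^\delta(\cdot,\gamma)$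 is bounded and uniformly continuous on $\overline{\mathcal G}$. -/

import Mathlib

open Set MeasureTheory
open scoped RealInnerProductSpace

namespace TrafficNetwork

/-- The state space `ℝᵐ` with its Euclidean norm. -/
abbrev State (m : ℕ) : Type := EuclideanSpace ℝ (Fin m)

/-- The open road `J_j = (0,1) e_j`. -/
def road {m N : ℕ} (e : Fin N → State m) (j : Fin N) : Set (State m) :=
  (fun r : ℝ => r • e j) '' Ioo 0 1

/-- The closed network, the union of the closed roads `[0,1] e_j`; the intersection is `0`. -/
def network {m N : ℕ} (e : Fin N → State m) : Set (State m) :=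
  ⋃ j, (fun r : ℝ => r • e j) '' Icc 0 1

/-- `y` solves `y' = b (y, α(t))` for `t ≥ 0`, `y 0 = x`, in the integrated (Carathéodory) sense.
Only the values of `α` and `y` at times `t ≥ 0` matter. For `b` bounded, continuous and one-sided
Lipschitz in the state, and `α` measurable, such a `y` exists and is unique on `[0, ∞)`. -/
def IsTrajectory {m : ℕ} {A : Type*} (b : State m → A → State m) (x : State m) (α : ℝ → A)
    (y : ℝ → State m) : Prop :=
  ContinuousOn y (Ici 0) ∧ ∀ t : ℝ, 0 ≤ t → y t = x + ∫ s in (0 : ℝ)..t, b (y s) (α s)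

/-- The network-constrained (feasible) controls from `x`: Borel controls whose trajectory stays
in the network forever. -/
def feasibleControls {m N : ℕ} {A : Type*} [MeasurableSpace A] (e : Fin N → State m)
    (b : State m → A → State m) (x : State m) : Set (ℝ → A) :=
  {α | Measurable α ∧ ∃ y, IsTrajectory b x α y ∧ ∀ t : ℝ, 0 ≤ t → y t ∈ network e}

/-- The control values that, applied as constant controls from `x`, keep the trajectory in the
network for some positive time. -/
def localControls {m N : ℕ} {A : Type*} (e : Fin N → State m)
    (b : State m → A → State m) (x : State m) : Set A :=
  {a | ∃ y, IsTrajectory b x (fun _ => a) y ∧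
    ∃ θ : ℝ, 0 < θ ∧ ∀ t ∈ Icc (0 : ℝ) θ, y t ∈ network e}

/-- The infinite-horizon discounted costs that can be achieved by feasible controls from `x`. -/
def costs {m N : ℕ} {A : Type*} [MeasurableSpace A] (e : Fin N → State m)
    (b : State m → A → State m) (c : State m → A → ℝ) (δ : ℝ) (x : State m) : Set ℝ :=
  {J | ∃ α ∈ feasibleControls e b x, ∃ y, IsTrajectory b x α y ∧
    J = ∫ t in Ioi (0 : ℝ), Real.exp (-δ * t) * c (y t) (α t)}

/-- The value function: the infimum of the achievable discounted costs. -/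
noncomputable def value {m N : ℕ} {A : Type*} [MeasurableSpace A] (e : Fin N → State m)
    (b : State m → A → State m) (c : State m → A → ℝ) (δ : ℝ) (x : State m) : ℝ :=
  sInf (costs e b c δ x)

/-- Regularity of the dynamics: uniformly continuous, bounded, one-sided Lipschitz in the state. -/
def RegularDynamics {m : ℕ} {A E : Type*} [MetricSpace A] (f : E → State m → A → State m) : Prop :=
  (∀ γ, UniformContinuous fun p : State m × A => f γ p.1 p.2) ∧
  ∃ C : ℝ, 0 < C ∧ ∀ γ x y a,
    ⟪f γ x a - f γ y a, x - y⟫ ≤ C * ‖x - y‖ ^ 2 ∧ ‖f γ x a‖ ≤ C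

/-- Regularity of the cost: uniformly continuous, bounded, Lipschitz in the state. -/
def RegularCost {m : ℕ} {A E : Type*} [MetricSpace A] (l : E → State m → A → ℝ) : Prop :=
  (∀ γ, UniformContinuous fun p : State m × A => l γ p.1 p.2) ∧
  ∃ C : ℝ, 0 < C ∧ ∀ γ x y a, |l γ x a - l γ y a| ≤ C * ‖x - y‖ ∧ |l γ x a| ≤ C

/-- `B γ j` is the (nonempty) set of controls of road `j` in configuration `γ`: it is the set of
locally admissible constant controls at every point of the open road, and it determines the locally
admissible controls at the intersection and at the vertices. At a vertex, either all controls of the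
road are admissible or one of them moves strictly inwards. -/
def RoadControls {m N : ℕ} {A E : Type*} (e : Fin N → State m)
    (f : E → State m → A → State m) (B : E → Fin N → Set A) : Prop :=
  ∀ γ : E,
    (∀ j, (B γ j).Nonempty) ∧
    (∀ j, ∀ x ∈ road e j, localControls e (f γ) x = B γ j) ∧
    (localControls e (f γ) 0 = ⋃ j, {a | a ∈ B γ j ∧ ∃ r : ℝ, 0 ≤ r ∧ f γ 0 a = r • e j}) ∧
    (∀ j, localControls e (f γ) (e j) = {a | a ∈ B γ j ∧ ⟪f γ (e j) a, e j⟫ ≤ 0}) ∧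
    (∀ j, (localControls e (f γ) (e j)).Nonempty) ∧
    (∀ j, localControls e (f γ) (e j) = B γ j ∨
      ∃ β : ℝ, 0 < β ∧ ∃ a ∈ B γ j, ⟪f γ (e j) a, e j⟫ < -β)

/-- Controllability near the intersection. On an active road one can move at the intersection in
both directions. On an inactive road some control leads back to the intersection, some control
allows one to wait there, and near the intersection no control of the road moves away from it. -/
def JunctionControllability {m N : ℕ} {A E : Type*} (e : Fin N → State m)
    (f : E → State m → A → State m) (B : E → Fin N → Set A) (active : Fin N → Set E) : Prop :=
  ∀ (γ : E) (j : Fin N),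
    (γ ∈ active j → ∃ β : ℝ, 0 < β ∧ ∃ aplus ∈ B γ j, ∃ aminus ∈ B γ j,
      ⟪f γ 0 aplus, e j⟫ > β ∧ ⟪f γ 0 aminus, e j⟫ < -β) ∧
    (γ ∉ active j → ∃ β η κ : ℝ, 0 < β ∧ 0 < η ∧ η < 1 ∧ 0 ≤ κ ∧ κ < 1 ∧
      ∃ aminus ∈ B γ j, ∃ azero ∈ B γ j,
        (∀ x ∈ road e j, ‖x‖ ≤ η → ⟪f γ x aminus, e j⟫ ≤ -β * ⟪x, e j⟫ ^ κ) ∧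
        f γ 0 azero = 0 ∧
        ∀ a ∈ B γ j, ∀ x ∈ road e j, ‖x‖ ≤ η → ⟪f γ x a, e j⟫ ≤ 0)

/-- On an inactive road, the cost at the intersection does not depend on the control of the road. -/
def InactiveCost {m N : ℕ} {A E : Type*} (l : E → State m → A → ℝ)
    (B : E → Fin N → Set A) (active : Fin N → Set E) : Prop :=
  ∀ (γ : E) (j : Fin N), γ ∉ active j → ∀ a ∈ B γ j, ∀ a' ∈ B γ j, l γ 0 a = l γ 0 a'

/-- Starting on the open road `j`, every feasible control initially uses only controls of that road,
on a time interval that depends on the starting point but not on the control. -/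
def RoadValued {m N : ℕ} {A E : Type*} [MeasurableSpace A] (e : Fin N → State m)
    (f : E → State m → A → State m) (B : E → Fin N → Set A) : Prop :=
  ∀ (j : Fin N) (γ : E), ∀ x ∈ road e j, ∃ θ : ℝ, 0 < θ ∧
    ∀ α ∈ feasibleControls e (f γ) x, ∀ᵐ t ∂(volume.restrict (Icc (0 : ℝ) θ)), α t ∈ B γ j

end TrafficNetwork

set_option linter.unusedSectionVars false

namespace TrafficNetwork

open Filter Topology

/-! ## Grönwall estimates -/

section

/-! Fix a configuration, with dynamics `b` and running cost `c`. Inside a closed road the controls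
of the road are tangent to it (`tangent`), so trajectories are governed by a scalar equation for the
coordinate along `e j`, with a velocity that is one-sided Lipschitz. Such equations are solvable
(`exists_scalar_solution`), and in dimension one their solutions can be compared by sign.

Feasibility: from a point of a road, a control that does not push outwards at the vertex either
keeps the trajectory on the road forever or brings it to the intersection. At the intersection one
can wait, or repeat forever an excursion along a road that can be entered
(`Setting.exists_feasible`). The cost being bounded by `K`, every value lies in `[-K/δ, K/δ]`.

Continuity: let `r • e j` and `s • e j` be close, and take a nearly optimal pair from the first
point. As long as it has not met the intersection, its control belongs almost everywhere to the
controls of the road (`IsFeasible.ae_mem`), so the same control can be run from the second point;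
Grönwall keeps the positions close up to a horizon beyond which discounting makes everything small.
The comparison stops earlier if one trajectory meets the intersection, or if the second one reaches
a vertex where it might leave. The two stopped positions then have nearly equal values, in the
required direction, by three local estimates: `Setting.value_le_value_zero`: the intersection is
reached in time of order `r ^ (1 - κ)`, with `κ < 1`; `Setting.value_zero_le`: an active road is
entered quickly, and on an inactive one waiting at the intersection costs about as much as staying
close to it; `Setting.value_vertex_le`: a vertex with a strictly inward control is left quickly.
Dynamic programming (`IsArc.value_le`) propagates these estimates and yields
`Setting.value_le_value`, a modulus of continuity on each road. Finitely many closed roads cover the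
compact network, whence uniform continuity. -/

theorem le_gronwallBound_of_increment {u : ℝ → ℝ} {T C ε L : ℝ}
    (hu : ContinuousOn u (Icc 0 T))
    (h : ∀ s t m, 0 ≤ s → s ≤ t → t ≤ T → (∀ τ ∈ Icc s t, C * u τ + ε ≤ m) →
      u t - u s ≤ m * (t - s) + L * (t - s) ^ 2) :
    ∀ t ∈ Icc 0 T, u t ≤ gronwallBound (u 0) C ε t := by
  intro t ht
  -- Carathéodory curves are differentiable only almost everywhere, so the hypothesis bounds
  -- increments instead; the quadratic error disappears in the right difference quotients.
  have key := le_gronwallBound_of_liminf_deriv_right_le (f := u) (f' := fun x => C * u x + ε)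
    (δ := u 0) (K := C) (ε := ε) (a := 0) (b := T) hu ?_ le_rfl (fun x _ => le_rfl) t ht
  · simpa using key
  intro x hx r hr
  apply Eventually.frequently
  -- One third of the gap absorbs the oscillation of `u` near `x`, another the term `L * (z - x)`,
  -- and a strict inequality is left.
  set η := (r - (C * u x + ε)) / 3 with hη
  have hη0 : 0 < η := by simp only [hη]; linarith
  have hcx : ContinuousWithinAt (fun z => C * u z + ε) (Icc x T) x :=
    (((hu x ⟨hx.1, hx.2.le⟩).const_mul C).add_const ε).mono (Icc_subset_Icc_left hx.1)
  have hev : ∀ᶠ z in 𝓝[Icc x T] x, C * u z + ε < C * u x + ε + η :=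
    hcx.eventually (eventually_lt_nhds (by linarith))
  rw [Metric.nhdsWithin_basis_ball.eventually_iff] at hev
  obtain ⟨d, hd, hball⟩ := hev
  have hlim : Tendsto (fun z : ℝ => L * (z - x)) (𝓝[>] x) (𝓝 0) := by
    have : Continuous fun z : ℝ => L * (z - x) := by fun_prop
    have h2 := this.tendsto x
    simp only [sub_self, mul_zero] at h2
    exact h2.mono_left nhdsWithin_le_nhds
  filter_upwards [hlim.eventually (eventually_lt_nhds hη0), self_mem_nhdsWithin,
    Ioo_mem_nhdsGT (show x < min T (x + d) from lt_min hx.2 (by linarith))] with z hz1 hz2 hz3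
  have hzx : 0 < z - x := sub_pos.2 hz2
  have hzT : z < T := hz3.2.trans_le (min_le_left _ _)
  have hzd : z < x + d := hz3.2.trans_le (min_le_right _ _)
  have := h x z (C * u x + ε + η) hx.1 hz3.1.le hzT.le (fun τ hτ => by
    refine (hball ⟨?_, hτ.1, hτ.2.trans hzT.le⟩).le
    rw [Metric.mem_ball, Real.dist_eq, abs_of_nonneg (by linarith [hτ.1])]
    linarith [hτ.2])
  rw [inv_mul_lt_iff₀ hzx]
  nlinarith

theorem sub_eq_integral {H : Type*} [NormedAddCommGroup H] [NormedSpace ℝ H]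
    {u φ : ℝ → H} {x : H} {T s t : ℝ}
    (hφ : IntervalIntegrable φ volume 0 T) (hu : ∀ t ∈ Icc 0 T, u t = x + ∫ s in (0:ℝ)..t, φ s)
    (hs : 0 ≤ s) (hst : s ≤ t) (htT : t ≤ T) : u t - u s = ∫ τ in s..t, φ τ := by
  rw [hu t ⟨hs.trans hst, htT⟩, hu s ⟨hs, hst.trans htT⟩, add_sub_add_left_eq_sub]
  apply intervalIntegral.integral_interval_sub_left
  · apply hφ.mono_set
    rw [uIcc_of_le (hs.trans hst), uIcc_of_le (hs.trans (hst.trans htT))]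
    exact Icc_subset_Icc_right htT
  · apply hφ.mono_set
    rw [uIcc_of_le hs, uIcc_of_le (hs.trans (hst.trans htT))]
    exact Icc_subset_Icc_right (hst.trans htT)

theorem intervalIntegrable_sub {H : Type*} [NormedAddCommGroup H] {φ : ℝ → H} {T s t : ℝ}
    (hφ : IntervalIntegrable φ volume 0 T) (hs : 0 ≤ s) (hst : s ≤ t) (htT : t ≤ T) :
    IntervalIntegrable φ volume s t := by
  apply hφ.mono_set
  rw [uIcc_of_le hst, uIcc_of_le (hs.trans (hst.trans htT))]
  exact Icc_subset_Icc hs htT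

theorem integral_le_of_ae_le_const {φ : ℝ → ℝ} {s t m : ℝ} (hst : s ≤ t)
    (hφ : IntervalIntegrable φ volume s t) (h : ∀ᵐ τ, τ ∈ Ioc s t → φ τ ≤ m) :
    ∫ τ in s..t, φ τ ≤ m * (t - s) := by
  have : ∫ τ in s..t, φ τ ≤ ∫ _ in s..t, m := by
    rw [intervalIntegral.integral_of_le hst, intervalIntegral.integral_of_le hst]
    apply integral_mono_ae hφ.1 (by simp)
    exact (ae_restrict_iff' measurableSet_Ioc).2 h
  simpa [mul_comm] using this

/-- Comparison with the zero solution: only the times at which `u` is positive matter. -/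
theorem le_gronwallBound_of_pos {u φ : ℝ → ℝ} {T C ε : ℝ} (hC : 0 ≤ C) (hε : 0 ≤ ε)
    (hc : ContinuousOn u (Icc 0 T)) (hφ : IntervalIntegrable φ volume 0 T)
    (hu : ∀ t ∈ Icc 0 T, u t = u 0 + ∫ s in (0 : ℝ)..t, φ s)
    (h : ∀ᵐ s, s ∈ Icc 0 T → 0 < u s → φ s ≤ C * u s + ε) :
    ∀ t ∈ Icc 0 T, u t ≤ gronwallBound (max (u 0) 0) C ε t := by
  intro t ht
  refine (le_max_left _ 0).trans
    (le_gronwallBound_of_increment (u := fun t => max (u t) 0) (L := 0)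
      ((continuous_id.max continuous_const).comp_continuousOn hc) ?_ t ht)
  clear t ht
  intro s t m hs hst htT hm
  have hm0 : 0 ≤ m := by
    refine le_trans ?_ (hm s ⟨le_rfl, hst⟩)
    have := le_max_right (u s) 0
    positivity
  rcases le_or_gt (u t) 0 with hut | hut
  · rw [max_eq_right hut]
    have := le_max_right (u s) 0
    have := mul_nonneg hm0 (sub_nonneg.2 hst)
    linarith
  -- the last time at which `u` is nonpositive
  have main : ∀ σ, s ≤ σ → σ ≤ t → max (u σ) 0 ≤ max (u s) 0 → (∀ τ ∈ Ioc σ t, 0 < u τ) →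
      max (u t) 0 - max (u s) 0 ≤ m * (t - s) + 0 * (t - s) ^ 2 := by
    intro σ hsσ hσt hσ hpos
    have h1 := sub_eq_integral hφ hu (hs.trans hsσ) hσt htT
    have h2 : ∫ τ in σ..t, φ τ ≤ m * (t - σ) := by
      apply integral_le_of_ae_le_const hσt (intervalIntegrable_sub hφ (hs.trans hsσ) hσt htT)
      filter_upwards [h] with τ hτ hτm
      refine (hτ ⟨by linarith [hτm.1], by linarith [hτm.2]⟩ (hpos τ hτm)).trans ?_
      have := hm τ ⟨by linarith [hτm.1], hτm.2⟩
      rwa [max_eq_left (hpos τ hτm).le] at this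
    have h3 := le_max_left (u σ) 0
    rw [max_eq_left hut.le]
    nlinarith
  by_cases hex : ∃ σ ∈ Icc s t, u σ ≤ 0
  · have hcl : IsCompact (Icc s t ∩ u ⁻¹' Iic 0) := by
      apply isCompact_Icc.of_isClosed_subset _ inter_subset_left
      exact (hc.mono (Icc_subset_Icc hs htT)).preimage_isClosed_of_isClosed isClosed_Icc isClosed_Iic
    obtain ⟨σ, ⟨hσ1, hσ2⟩, hmax⟩ := hcl.exists_isGreatest
      (by obtain ⟨σ, h1, h2⟩ := hex; exact ⟨σ, h1, h2⟩)
    refine main σ hσ1.1 hσ1.2 ?_ ?_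
    · rw [max_eq_right (show u σ ≤ 0 from hσ2)]; exact le_max_right _ _
    · intro τ hτ
      by_contra hneg
      have := hmax (show τ ∈ _ from ⟨⟨hσ1.1.trans hτ.1.le, hτ.2⟩, not_lt.1 hneg⟩)
      linarith [hτ.1]
  · push Not at hex
    exact main s le_rfl hst le_rfl (fun τ hτ => hex τ ⟨hτ.1.le, hτ.2⟩)

/-- A curve starting at `0` with bounded velocity `φ` vanishes if `⟪φ, w⟫ ≤ C ‖w‖ ^ 2`. -/
theorem eq_zero_of_inner_le {H : Type*} [NormedAddCommGroup H] [InnerProductSpace ℝ H]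
    [CompleteSpace H] {w φ : ℝ → H} {T C M : ℝ} (hc : ContinuousOn w (Icc 0 T))
    (hφ : IntervalIntegrable φ volume 0 T) (hw : ∀ t ∈ Icc 0 T, w t = 0 + ∫ s in (0 : ℝ)..t, φ s)
    (hM : ∀ s, ‖φ s‖ ≤ M) (h : ∀ s ∈ Icc 0 T, ⟪φ s, w s⟫ ≤ C * ‖w s‖ ^ 2) :
    ∀ t ∈ Icc 0 T, w t = 0 := by
  intro t ht
  have key := le_gronwallBound_of_increment (u := fun t => ‖w t‖ ^ 2) (C := 2 * C) (ε := 0)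
    (T := T) (L := 3 * M ^ 2) (hc.norm.pow 2) ?_ t ht
  · have h0 : w 0 = 0 := by simpa using hw 0 ⟨le_rfl, ht.1.trans ht.2⟩
    simp only [h0, norm_zero, gronwallBound_ε0] at key
    have : ‖w t‖ ^ 2 = 0 := le_antisymm (by simpa using key) (by positivity)
    simpa using this
  clear t ht
  intro s t m hs hst htT hm
  have hM0 : 0 ≤ M := (norm_nonneg _).trans (hM 0)
  have hinc : ∀ a b, s ≤ a → a ≤ b → b ≤ t → ‖w b - w a‖ ≤ M * (b - a) := by
    intro a b ha hab hb
    rw [sub_eq_integral hφ hw (hs.trans ha) hab (hb.trans htT)]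
    have := intervalIntegral.norm_integral_le_of_norm_le_const (a := a) (b := b) (f := φ) (C := M)
      (fun x _ => hM x)
    rwa [abs_of_nonneg (sub_nonneg.2 hab)] at this
  -- Expanding the square avoids differentiating the norm. Replacing `w s` by `w τ` in the inner
  -- product costs `M ^ 2 * (t - s)`, which counts twice; with the last square this makes `L = 3 * M
  -- ^ 2`.
  have h1 : ‖w t‖ ^ 2 - ‖w s‖ ^ 2 = 2 * ⟪w s, w t - w s⟫ + ‖w t - w s‖ ^ 2 := by
    have := norm_add_sq_real (w s) (w t - w s)
    rw [add_sub_cancel] at this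
    linarith
  have hint := intervalIntegrable_sub hφ hs hst htT
  have h2 : ⟪w s, w t - w s⟫ = ∫ τ in s..t, ⟪w s, φ τ⟫ := by
    rw [sub_eq_integral hφ hw hs hst htT]
    exact ((innerSL ℝ (w s)).intervalIntegral_comp_comm hint).symm
  have h3 : ∫ τ in s..t, ⟪w s, φ τ⟫ ≤ (m / 2 + M ^ 2 * (t - s)) * (t - s) := by
    apply integral_le_of_ae_le_const hst
    · exact ⟨(innerSL ℝ (w s)).integrable_comp hint.1, (innerSL ℝ (w s)).integrable_comp hint.2⟩
    · refine Eventually.of_forall fun τ hτ => ?_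
      have e1 : ⟪w s, φ τ⟫ = ⟪φ τ, w τ⟫ - ⟪φ τ, w τ - w s⟫ := by
        rw [inner_sub_right, real_inner_comm]; ring
      have e2 := h τ ⟨hs.trans hτ.1.le, hτ.2.trans htT⟩
      have e3 := hm τ ⟨hτ.1.le, hτ.2⟩
      have e4 : -⟪φ τ, w τ - w s⟫ ≤ M * (M * (t - s)) := by
        refine (neg_le_abs _).trans ((abs_real_inner_le_norm _ _).trans ?_)
        refine mul_le_mul (hM τ) ?_ (norm_nonneg _) hM0
        refine (hinc s τ le_rfl hτ.1.le hτ.2).trans ?_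
        gcongr
        exact hτ.2
      rw [e1]
      nlinarith
  have h4 : ‖w t - w s‖ ^ 2 ≤ (M * (t - s)) ^ 2 := by
    gcongr
    exact hinc s t le_rfl hst le_rfl
  nlinarith

end

/-! ## Scalar Carathéodory equations -/

section

variable {A : Type*} [MetricSpace A] [CompactSpace A] [MeasurableSpace A] [BorelSpace A]

theorem intervalIntegrable_of_bound {F : Type*} [NormedAddCommGroup F] {φ : ℝ → F} {s t M : ℝ}
    (hst : s ≤ t) (hφ : AEStronglyMeasurable φ (volume.restrict (Ioc s t)))
    (hM : ∀ τ, ‖φ τ‖ ≤ M) : IntervalIntegrable φ volume s t := by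
  rw [intervalIntegrable_iff_integrableOn_Ioc_of_le hst]
  exact Integrable.of_bound hφ M (Eventually.of_forall hM)

theorem aestronglyMeasurable_comp_pair {H F : Type*} [NormedAddCommGroup H]
    [MeasurableSpace H] [BorelSpace H] [SecondCountableTopology H]
    [NormedAddCommGroup F] [MeasurableSpace F] [BorelSpace F] [SecondCountableTopology F]
    {b : H → A → F} (hb : Continuous fun p : H × A => b p.1 p.2) {y : ℝ → H} {α : ℝ → A}
    (hα : Measurable α) {S : Set ℝ} (hS : MeasurableSet S) (hy : ContinuousOn y S) :
    AEStronglyMeasurable (fun s => b (y s) (α s)) (volume.restrict S) := by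
  have h1 : AEMeasurable y (volume.restrict S) := hy.aemeasurable hS
  exact (hb.measurable.comp_aemeasurable (h1.prodMk hα.aemeasurable)).aestronglyMeasurable

theorem abs_sub_le_of_integral {u φ : ℝ → ℝ} {x M s t : ℝ}
    (hφ : ∀ T, 0 ≤ T → IntervalIntegrable φ volume 0 T) (hM : ∀ τ, ‖φ τ‖ ≤ M)
    (hu : ∀ t, 0 ≤ t → u t = x + ∫ s in (0:ℝ)..t, φ s) (hs : 0 ≤ s) (hst : s ≤ t) :
    |u t - u s| ≤ M * (t - s) := by
  rw [sub_eq_integral (hφ t (hs.trans hst)) (fun τ hτ => hu τ hτ.1) hs hst le_rfl]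
  have := intervalIntegral.norm_integral_le_of_norm_le_const (a := s) (b := t) (f := φ) (C := M)
    (fun x _ => hM x)
  rwa [abs_of_nonneg (sub_nonneg.2 hst)] at this

theorem continuousOn_of_integral {H : Type*} [NormedAddCommGroup H] [NormedSpace ℝ H]
    {u φ : ℝ → H} {x : H} {T : ℝ} (hT : 0 ≤ T)
    (hφ : IntervalIntegrable φ volume 0 T)
    (hu : ∀ t ∈ Icc 0 T, u t = x + ∫ s in (0:ℝ)..t, φ s) : ContinuousOn u (Icc 0 T) := by
  have : ContinuousOn (fun t => x + ∫ s in (0:ℝ)..t, φ s) (Icc 0 T) := by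
    refine continuousOn_const.add ?_
    have := intervalIntegral.continuousOn_primitive_interval (f := φ) (μ := volume) (a := 0) (b := T)
      (by rw [uIcc_of_le hT, integrableOn_Icc_iff_integrableOn_Ioc]; exact hφ.1)
    rwa [uIcc_of_le hT] at this
  exact this.congr hu

/-- The nodes of the explicit Euler scheme with step `h`. -/
noncomputable def eulerNode (g : ℝ → A → ℝ) (α : ℝ → A) (r h : ℝ) : ℕ → ℝ
  | 0 => r
  | k + 1 => eulerNode g α r h k + ∫ s in (k * h)..((k + 1) * h), g (eulerNode g α r h k) (α s)

/-- The position is frozen at the last node: `p` is a step function and `u` the integral of the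
resulting velocity. They agree at the nodes and drift apart by at most `M * h` within one step. -/
theorem exists_euler {g : ℝ → A → ℝ} (hg : Continuous fun p : ℝ × A => g p.1 p.2) {M : ℝ}
    (hM : ∀ r a, |g r a| ≤ M) {α : ℝ → A} (hα : Measurable α) (r : ℝ) {h : ℝ} (hh : 0 < h) :
    ∃ p u : ℝ → ℝ, Measurable p ∧ (∀ t, 0 ≤ t → u t = r + ∫ s in (0:ℝ)..t, g (p s) (α s)) ∧
      ∀ t, 0 ≤ t → |u t - p t| ≤ M * h := by
  set c := eulerNode g α r h with hc
  set p : ℝ → ℝ := fun s => c ⌊s / h⌋₊ with hp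
  have hpm : Measurable p :=
    (measurable_from_nat (f := c)).comp (Nat.measurable_floor.comp (measurable_id.div_const h))
  have hφm : Measurable fun s => g (p s) (α s) := hg.measurable.comp (hpm.prodMk hα)
  have hφb : ∀ τ, ‖g (p τ) (α τ)‖ ≤ M := fun τ => hM _ _
  have hM0 : 0 ≤ M := (norm_nonneg _).trans (hφb 0)
  have hφi : ∀ T, 0 ≤ T → IntervalIntegrable (fun s => g (p s) (α s)) volume 0 T := fun T hT =>
    intervalIntegrable_of_bound hT hφm.aestronglyMeasurable hφb
  set u : ℝ → ℝ := fun t => r + ∫ s in (0:ℝ)..t, g (p s) (α s) with hu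
  have huk : ∀ k : ℕ, u (k * h) = c k := by
    intro k
    induction k with
    | zero => simp [hu, hc, eulerNode]
    | succ k ih =>
      have hk : (0:ℝ) ≤ k * h := by positivity
      have hk1 : (k:ℝ) * h ≤ (k + 1) * h := by nlinarith
      have e1 : u ((k + 1) * h) - u (k * h) = ∫ s in (k * h)..((k + 1) * h), g (p s) (α s) :=
        sub_eq_integral (hφi _ (hk.trans hk1)) (fun τ _ => rfl) hk hk1 le_rfl
      have e2 : ∫ s in (k * h)..((k + 1) * h), g (p s) (α s)
          = ∫ s in (k * h)..((k + 1) * h), g (c k) (α s) := by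
        apply intervalIntegral.integral_congr_ae
        -- The floor jumps at the right end of the step, which is discarded as a null set.
        have hne : ∀ᵐ s : ℝ, s ≠ (k + 1) * h := by
          simp [ae_iff]
        filter_upwards [hne] with s hs hmem
        rw [uIoc_of_le hk1] at hmem
        have : ⌊s / h⌋₊ = k := by
          rw [Nat.floor_eq_iff (div_nonneg (hk.trans hmem.1.le) hh.le)]
          refine ⟨(le_div_iff₀ hh).2 hmem.1.le, (div_lt_iff₀ hh).2 (lt_of_le_of_ne hmem.2 hs)⟩
        simp only [hp, this]
      have e3 : c (k + 1) = c k + ∫ s in (k * h)..((k + 1) * h), g (c k) (α s) := rfl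
      push_cast
      rw [e3, ← e2, ← e1, ih]
      ring
  refine ⟨p, u, hpm, fun t _ => rfl, fun t ht => ?_⟩
  have h1 : (⌊t / h⌋₊ : ℝ) * h ≤ t := (le_div_iff₀ hh).1 (Nat.floor_le (div_nonneg ht hh.le))
  have h2 : t < (⌊t / h⌋₊ + 1) * h := (div_lt_iff₀ hh).1 (Nat.lt_floor_add_one _)
  have h3 := abs_sub_le_of_integral (u := u) hφi hφb (fun _ _ => rfl)
    (by positivity : (0:ℝ) ≤ ⌊t / h⌋₊ * h) h1
  rw [huk] at h3
  refine h3.trans ?_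
  gcongr
  linarith

/-- Existence for scalar Carathéodory equations with a one-sided Lipschitz right-hand side. -/
theorem exists_scalar_solution {g : ℝ → A → ℝ} (hg : UniformContinuous fun p : ℝ × A => g p.1 p.2)
    {M C : ℝ} (hC : 0 ≤ C) (hM : ∀ r a, |g r a| ≤ M)
    (hos : ∀ r s a, s ≤ r → g r a - g s a ≤ C * (r - s))
    {α : ℝ → A} (hα : Measurable α) (r : ℝ) :
    ∃ q : ℝ → ℝ, (∀ T, ContinuousOn q (Icc 0 T)) ∧
      ∀ t, 0 ≤ t → q t = r + ∫ s in (0:ℝ)..t, g (q s) (α s) := by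
  have hM0 : 0 ≤ M := (abs_nonneg _).trans (hM 0 (α 0))
  choose p u hpm hu hup using fun n : ℕ =>
    exists_euler hg.continuous hM hα r (h := 1 / ((n:ℝ) + 1)) (by positivity)
  have hφm : ∀ n, Measurable fun s => g (p n s) (α s) := fun n =>
    hg.continuous.measurable.comp ((hpm n).prodMk hα)
  have hφi : ∀ n T, 0 ≤ T → IntervalIntegrable (fun s => g (p n s) (α s)) volume 0 T :=
    fun n T hT => intervalIntegrable_of_bound hT (hφm n).aestronglyMeasurable (fun τ => hM _ _)
  have hstep : Tendsto (fun n : ℕ => M * (1 / ((n:ℝ) + 1))) atTop (𝓝 0) := by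
    simpa using tendsto_one_div_add_atTop_nhds_zero_nat.const_mul M
  -- comparison of two Euler approximations
  have hcomp : ∀ ε > 0, ∃ n₀, ∀ n ≥ n₀, ∀ k ≥ n₀, ∀ t, 0 ≤ t →
      u n t - u k t ≤ gronwallBound 0 C ε t := by
    intro ε hε
    rw [Metric.uniformContinuous_iff] at hg
    obtain ⟨d, hd, hgd⟩ := hg (ε / 2) (by positivity)
    obtain ⟨n₀, hn₀⟩ := eventually_atTop.1 (hstep.eventually (eventually_lt_nhds hd))
    refine ⟨n₀, fun n hn k hk t ht => ?_⟩
    have hclose : ∀ n ≥ n₀, ∀ s, 0 ≤ s → |g (u n s) (α s) - g (p n s) (α s)| < ε / 2 := by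
      intro n hn s hs
      have := hgd (a := (u n s, α s)) (b := (p n s, α s)) (by
        rw [Prod.dist_eq, dist_self, max_eq_left dist_nonneg, Real.dist_eq]
        exact (hup n s hs).trans_lt (hn₀ n hn))
      rwa [Real.dist_eq] at this
    have h0 : ∀ n, u n 0 = r := fun n => by simpa using hu n 0 le_rfl
    have hint := (hφi n t ht).sub (hφi k t ht)
    have huv : ∀ τ ∈ Icc 0 t, u n τ - u k τ = u n 0 - u k 0
        + ∫ s in (0:ℝ)..τ, (g (p n s) (α s) - g (p k s) (α s)) := by
      intro τ hτ
      rw [intervalIntegral.integral_sub (hφi n τ hτ.1) (hφi k τ hτ.1), hu n τ hτ.1, hu k τ hτ.1,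
        h0, h0]
      ring
    have := le_gronwallBound_of_pos (u := fun t => u n t - u k t) hC hε.le
      (continuousOn_of_integral ht hint huv) hint huv ?_ t ⟨ht, le_rfl⟩
    · simpa [h0] using this
    · refine Eventually.of_forall fun s hs hpos => ?_
      have h1 := hclose n hn s hs.1
      have h2 := hclose k hk s hs.1
      have h3 := hos (u n s) (u k s) (α s) (by linarith)
      rw [abs_lt] at h1 h2
      linarith
  have hconv : ∀ t, 0 ≤ t → ∃ q, Tendsto (fun n => u n t) atTop (𝓝 q) := by
    intro t ht
    apply cauchySeq_tendsto_of_complete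
    rw [Metric.cauchySeq_iff]
    intro ε hε
    have hlim : Tendsto (fun ε' => gronwallBound 0 C ε' t) (𝓝[>] 0) (𝓝 0) := by
      have := (gronwallBound_continuous_ε 0 C t).tendsto 0
      rw [gronwallBound_ε0_δ0] at this
      exact this.mono_left nhdsWithin_le_nhds
    obtain ⟨ε', h1, h2⟩ := ((hlim.eventually (eventually_lt_nhds hε)).and
      self_mem_nhdsWithin).exists
    obtain ⟨n₀, hn₀⟩ := hcomp ε' h2
    refine ⟨n₀, fun n hn k hk => ?_⟩
    rw [Real.dist_eq, abs_lt]
    have := hn₀ n hn k hk t ht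
    have := hn₀ k hk n hn t ht
    constructor <;> linarith
  choose! q hq using hconv
  have hp : ∀ t, 0 ≤ t → Tendsto (fun n => p n t) atTop (𝓝 (q t)) := by
    intro t ht
    have h1 : Tendsto (fun n => u n t - p n t) atTop (𝓝 0) :=
      squeeze_zero_norm (fun n => hup n t ht) hstep
    simpa using (hq t ht).sub h1
  have hgc : ∀ t, 0 ≤ t → Tendsto (fun n => g (p n t) (α t)) atTop (𝓝 (g (q t) (α t))) := by
    intro t ht
    exact (hg.continuous.tendsto (q t, α t)).comp ((hp t ht).prodMk_nhds tendsto_const_nhds)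
  have hqint : ∀ t, 0 ≤ t → q t = r + ∫ s in (0:ℝ)..t, g (q s) (α s) := by
    intro t ht
    refine tendsto_nhds_unique (hq t ht) ?_
    simp_rw [hu _ t ht]
    refine tendsto_const_nhds.add ?_
    refine intervalIntegral.tendsto_integral_filter_of_dominated_convergence (fun _ => M)
      (Eventually.of_forall fun n => (hφm n).aestronglyMeasurable)
      (Eventually.of_forall fun n => Eventually.of_forall fun s _ => hM _ _) (by simp) ?_
    refine Eventually.of_forall fun s hs => hgc s ?_
    rw [uIoc_of_le ht] at hs
    exact hs.1.le
  refine ⟨q, fun T => ?_, hqint⟩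
  rcases le_or_gt 0 T with hT | hT
  · refine continuousOn_of_integral hT ?_ (fun t ht => hqint t ht.1)
    refine intervalIntegrable_of_bound hT ?_ (fun τ => hM _ _)
    refine aestronglyMeasurable_of_tendsto_ae (u := atTop)
      (f := fun n s => g (p n s) (α s)) (fun n => (hφm n).aestronglyMeasurable) ?_
    rw [ae_restrict_iff' measurableSet_Ioc]
    exact Eventually.of_forall fun s hs => hgc s hs.1.le
  · rw [Icc_eq_empty (not_le.2 hT)]; exact continuousOn_empty _

end

/-! ## Arcs and feasible pairs -/

section

variable {m N : ℕ} {A : Type*} [MetricSpace A] [CompactSpace A] [MeasurableSpace A] [BorelSpace A]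

/-- The regularity of one configuration: dynamics `b` and running cost `c`. -/
structure IsRegular (b : State m → A → State m) (c : State m → A → ℝ) (C K : ℝ) : Prop where
  C_pos : 0 < C
  K_pos : 0 < K
  unif : UniformContinuous fun p : State m × A => b p.1 p.2
  bound : ∀ x a, ‖b x a‖ ≤ C
  oneSided : ∀ x y a, ⟪b x a - b y a, x - y⟫ ≤ C * ‖x - y‖ ^ 2
  cost_cont : Continuous fun p : State m × A => c p.1 p.2
  cost_lip : ∀ x y a, |c x a - c y a| ≤ K * ‖x - y‖
  cost_bound : ∀ x a, |c x a| ≤ K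

/-- A trajectory on `[0,T]` that stays in the network, with its control. -/
structure IsArc (e : Fin N → State m) (b : State m → A → State m) (x : State m) (T : ℝ)
    (α : ℝ → A) (y : ℝ → State m) : Prop where
  meas : Measurable α
  cont : ContinuousOn y (Icc 0 T)
  eq : ∀ t ∈ Icc 0 T, y t = x + ∫ s in (0 : ℝ)..t, b (y s) (α s)
  mem : ∀ t ∈ Icc 0 T, y t ∈ network e

/-- A control with its trajectory, which stays in the network forever. -/
def IsFeasible (e : Fin N → State m) (b : State m → A → State m) (x : State m)
    (α : ℝ → A) (y : ℝ → State m) : Prop := ∀ T, 0 ≤ T → IsArc e b x T α y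

variable {e : Fin N → State m} {b : State m → A → State m} {c : State m → A → ℝ}
  {C K : ℝ} {x : State m} {T : ℝ} {α : ℝ → A} {y : ℝ → State m}

theorem isFeasible_iff : IsFeasible e b x α y ↔
    Measurable α ∧ IsTrajectory b x α y ∧ ∀ t : ℝ, 0 ≤ t → y t ∈ network e := by
  constructor
  · intro h
    refine ⟨(h 0 le_rfl).meas, ⟨?_, fun t ht => (h t ht).eq t ⟨ht, le_rfl⟩⟩,
      fun t ht => (h t ht).mem t ⟨ht, le_rfl⟩⟩
    intro t (ht : 0 ≤ t)
    refine ((h (t + 1) (by linarith)).cont t ⟨ht, by linarith⟩).mono_of_mem_nhdsWithin ?_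
    -- The compact interval `[0, t + 1]` is a neighbourhood of `t` within the half-line, so
    -- continuity on it suffices.
    rw [← Ici_inter_Iic]
    exact inter_mem self_mem_nhdsWithin (mem_nhdsWithin_of_mem_nhds (Iic_mem_nhds (by linarith)))
  · rintro ⟨h1, ⟨h2, h3⟩, h4⟩ T hT
    exact ⟨h1, h2.mono fun t ht => ht.1, fun t ht => h3 t ht.1, fun t ht => h4 t ht.1⟩

theorem IsArc.zero (h : IsArc e b x T α y) (hT : 0 ≤ T) : y 0 = x := by
  simpa using h.eq 0 ⟨le_rfl, hT⟩

theorem IsArc.mono (h : IsArc e b x T α y) {S : ℝ} (hS : S ≤ T) : IsArc e b x S α y :=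
  ⟨h.meas, h.cont.mono (Icc_subset_Icc_right hS), fun t ht => h.eq t ⟨ht.1, ht.2.trans hS⟩,
    fun t ht => h.mem t ⟨ht.1, ht.2.trans hS⟩⟩

theorem IsRegular.intervalIntegrable (hr : IsRegular b c C K) (hα : Measurable α) (hT : 0 ≤ T)
    (hy : ContinuousOn y (Icc 0 T)) :
    IntervalIntegrable (fun s => b (y s) (α s)) volume 0 T :=
  intervalIntegrable_of_bound hT
    (aestronglyMeasurable_comp_pair hr.unif.continuous hα measurableSet_Ioc
      (hy.mono Ioc_subset_Icc_self)) (fun _ => hr.bound _ _)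

theorem IsTrajectory.unique (hr : IsRegular b c C K) (hα : Measurable α) {y' : ℝ → State m}
    (h : IsTrajectory b x α y) (h' : IsTrajectory b x α y') {t : ℝ} (ht : 0 ≤ t) :
    y t = y' t := by
  have hi := hr.intervalIntegrable hα ht (h.1.mono fun s hs => hs.1)
  have hi' := hr.intervalIntegrable hα ht (h'.1.mono fun s hs => hs.1)
  rw [← sub_eq_zero]
  refine eq_zero_of_inner_le (w := fun t => y t - y' t) (T := t) (C := C) (M := C + C)
    (φ := fun s => b (y s) (α s) - b (y' s) (α s))
    ((h.1.sub h'.1).mono fun s hs => hs.1) (hi.sub hi') ?_ ?_ ?_ t ⟨ht, le_rfl⟩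
  · intro s hs
    have j := hr.intervalIntegrable hα hs.1 (h.1.mono fun s hs => hs.1)
    have j' := hr.intervalIntegrable hα hs.1 (h'.1.mono fun s hs => hs.1)
    rw [intervalIntegral.integral_sub j j']
    simp only [h.2 s hs.1, h'.2 s hs.1]
    abel
  · exact fun s => (norm_sub_le _ _).trans (add_le_add (hr.bound _ _) (hr.bound _ _))
  · exact fun s _ => hr.oneSided _ _ _

/-- Follow `f` until time `T` and then `g`, restarted at `T`. -/
noncomputable def glue {X : Type*} (T : ℝ) (f g : ℝ → X) (t : ℝ) : X :=
  if t ≤ T then f t else g (t - T)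

theorem glue_of_le {X : Type*} {T : ℝ} {f g : ℝ → X} {t : ℝ} (h : t ≤ T) : glue T f g t = f t :=
  if_pos h

theorem glue_of_lt {X : Type*} {T : ℝ} {f g : ℝ → X} {t : ℝ} (h : T < t) :
    glue T f g t = g (t - T) := if_neg (not_le.2 h)

theorem measurable_glue {X : Type*} [MeasurableSpace X] {T : ℝ} {f g : ℝ → X}
    (hf : Measurable f) (hg : Measurable g) : Measurable (glue T f g) :=
  Measurable.ite measurableSet_Iic hf (hg.comp (measurable_id.sub_const T))

theorem IsArc.append (hr : IsRegular b c C K) {T₁ T₂ : ℝ} {α₁ α₂ : ℝ → A} {y₁ y₂ : ℝ → State m}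
    (h₁ : IsArc e b x T₁ α₁ y₁) (h₂ : IsArc e b (y₁ T₁) T₂ α₂ y₂) (hT₁ : 0 ≤ T₁) (hT₂ : 0 ≤ T₂) :
    IsArc e b x (T₁ + T₂) (glue T₁ α₁ α₂) (glue T₁ y₁ y₂) := by
  have hi₁ := hr.intervalIntegrable h₁.meas hT₁ h₁.cont
  have hi₂ := hr.intervalIntegrable h₂.meas hT₂ h₂.cont
  set φ := fun s => b (glue T₁ y₁ y₂ s) (glue T₁ α₁ α₂ s) with hφ
  have c1 : ∀ s ≤ T₁, b (y₁ s) (α₁ s) = φ s := fun s hs => by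
    simp only [hφ, glue_of_le hs]
  have c2 : ∀ s, T₁ < s → b (y₂ (s - T₁)) (α₂ (s - T₁)) = φ s := fun s hs => by
    simp only [hφ, glue_of_lt hs]
  have j₁ : IntervalIntegrable φ volume 0 T₁ := hi₁.congr (by
    intro s hs; rw [uIoc_of_le hT₁] at hs; exact c1 s hs.2)
  have j₂ : IntervalIntegrable φ volume T₁ (T₁ + T₂) := by
    have := hi₂.comp_sub_right T₁
    rw [zero_add, add_comm T₂] at this
    refine this.congr ?_
    intro s hs; rw [uIoc_of_le (by linarith)] at hs; exact c2 s hs.1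
  have heq : ∀ t ∈ Icc 0 (T₁ + T₂), glue T₁ y₁ y₂ t = x + ∫ s in (0:ℝ)..t, φ s := by
    intro t ht
    have hle : ∀ t, 0 ≤ t → t ≤ T₁ → ∫ s in (0:ℝ)..t, φ s = ∫ s in (0:ℝ)..t, b (y₁ s) (α₁ s) := by
      intro t ht0 ht1
      refine intervalIntegral.integral_congr fun s hs => ?_
      rw [uIcc_of_le ht0] at hs
      exact (c1 s (hs.2.trans ht1)).symm
    rcases le_or_gt t T₁ with htT | htT
    · rw [glue_of_le htT, h₁.eq t ⟨ht.1, htT⟩, hle t ht.1 htT]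
    · rw [glue_of_lt htT, h₂.eq (t - T₁) ⟨by linarith, by linarith [ht.2]⟩,
        ← intervalIntegral.integral_add_adjacent_intervals j₁ (j₂.mono_set (by
          rw [uIcc_of_le htT.le, uIcc_of_le (by linarith)]; exact Icc_subset_Icc_right ht.2)),
        hle T₁ hT₁ le_rfl, h₁.eq T₁ ⟨hT₁, le_rfl⟩, ← add_assoc]
      congr 1
      have := intervalIntegral.integral_comp_sub_right (a := T₁) (b := t)
        (fun s => b (y₂ s) (α₂ s)) T₁
      rw [sub_self] at this
      rw [← this]
      refine intervalIntegral.integral_congr_ae (Eventually.of_forall fun s hs => ?_)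
      rw [uIoc_of_le htT.le] at hs
      exact c2 s hs.1
  refine ⟨measurable_glue h₁.meas h₂.meas,
    continuousOn_of_integral (by linarith) (j₁.trans j₂) heq, heq, fun t ht => ?_⟩
  rcases le_or_gt t T₁ with htT | htT
  · rw [glue_of_le htT]; exact h₁.mem t ⟨ht.1, htT⟩
  · rw [glue_of_lt htT]; exact h₂.mem _ ⟨by linarith, by linarith [ht.2]⟩

theorem IsArc.append_feasible (hr : IsRegular b c C K) {T₁ : ℝ} {α₁ α₂ : ℝ → A}
    {y₁ y₂ : ℝ → State m} (h₁ : IsArc e b x T₁ α₁ y₁) (h₂ : IsFeasible e b (y₁ T₁) α₂ y₂)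
    (hT₁ : 0 ≤ T₁) : IsFeasible e b x (glue T₁ α₁ α₂)
      (glue T₁ y₁ y₂) := by
  intro T hT
  exact (h₁.append hr (h₂ T hT) hT₁ hT).mono (by linarith)

theorem IsFeasible.shift (hr : IsRegular b c C K) (h : IsFeasible e b x α y) {τ : ℝ}
    (hτ : 0 ≤ τ) : IsFeasible e b (y τ) (fun t => α (t + τ)) (fun t => y (t + τ)) := by
  intro T hT
  have hm : MapsTo (fun t : ℝ => t + τ) (Icc 0 T) (Icc 0 (T + τ)) := fun t ht =>
    ⟨by linarith [ht.1], by linarith [ht.2]⟩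
  have hA := h (T + τ) (by linarith)
  refine ⟨hA.meas.comp (measurable_add_const τ),
    hA.cont.comp (by fun_prop) hm, fun t ht => ?_, fun t ht => hA.mem _ (hm ht)⟩
  have hi := hr.intervalIntegrable hA.meas (by linarith) hA.cont
  have e1 := sub_eq_integral hi hA.eq hτ (by linarith [ht.1] : τ ≤ t + τ) (hm ht).2
  have e2 := intervalIntegral.integral_comp_add_right (a := 0) (b := t)
    (fun s => b (y s) (α s)) τ
  rw [zero_add] at e2
  simp only [e2, ← e1]
  abel

end

/-! ## Costs and dynamic programming -/

section

variable {m N : ℕ} {A : Type*} [MetricSpace A] [CompactSpace A] [MeasurableSpace A] [BorelSpace A]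

variable {e : Fin N → State m} {b : State m → A → State m} {c : State m → A → ℝ}
  {C K δ : ℝ} {x z : State m} {T : ℝ} {α : ℝ → A} {y : ℝ → State m}

/-- The discounted running cost. -/
noncomputable def rate (c : State m → A → ℝ) (δ : ℝ) (α : ℝ → A) (y : ℝ → State m) (t : ℝ) : ℝ :=
  Real.exp (-δ * t) * c (y t) (α t)

/-- The discounted cost over the infinite horizon. -/
noncomputable def cost (c : State m → A → ℝ) (δ : ℝ) (α : ℝ → A) (y : ℝ → State m) : ℝ :=
  ∫ t in Ioi (0 : ℝ), rate c δ α y t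

theorem integral_exp_neg (hδ : 0 < δ) : ∫ t in Ioi (0:ℝ), Real.exp (-δ * t) = 1 / δ := by
  rw [integral_exp_mul_Ioi (neg_lt_zero.2 hδ)]
  simp

theorem integrableOn_exp_neg (hδ : 0 < δ) :
    IntegrableOn (fun t => Real.exp (-δ * t)) (Ioi (0:ℝ)) :=
  integrableOn_exp_mul_Ioi (neg_lt_zero.2 hδ) 0

theorem abs_rate_le (hr : IsRegular b c C K) (t : ℝ) :
    |rate c δ α y t| ≤ K * Real.exp (-δ * t) := by
  rw [rate, abs_mul, abs_of_pos (Real.exp_pos _), mul_comm]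
  gcongr
  exact hr.cost_bound _ _

theorem IsRegular.integrableOn_rate (hr : IsRegular b c C K) (hδ : 0 < δ) {S : Set ℝ}
    (hS : MeasurableSet S) (hS0 : S ⊆ Ioi 0) (hα : Measurable α) (hy : ContinuousOn y S) :
    IntegrableOn (rate c δ α y) S := by
  refine Integrable.mono' (((integrableOn_exp_neg hδ).mono_set hS0).const_mul K) ?_
    (Eventually.of_forall fun t => abs_rate_le hr t)
  refine AEStronglyMeasurable.mul ?_ (aestronglyMeasurable_comp_pair hr.cost_cont hα hS hy)
  exact (by fun_prop : Continuous fun t : ℝ => Real.exp (-δ * t)).aestronglyMeasurable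

theorem IsFeasible.continuousOn (h : IsFeasible e b x α y) : ContinuousOn y (Ici 0) :=
  (isFeasible_iff.1 h).2.1.1

theorem IsFeasible.integrableOn_rate (hr : IsRegular b c C K) (hδ : 0 < δ)
    (h : IsFeasible e b x α y) : IntegrableOn (rate c δ α y) (Ioi 0) :=
  hr.integrableOn_rate hδ measurableSet_Ioi Subset.rfl (h 0 le_rfl).meas
    (h.continuousOn.mono Ioi_subset_Ici_self)

theorem IsArc.intervalIntegrable_rate (hr : IsRegular b c C K) (hδ : 0 < δ)
    (h : IsArc e b x T α y) (hT : 0 ≤ T) : IntervalIntegrable (rate c δ α y) volume 0 T := by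
  rw [intervalIntegrable_iff_integrableOn_Ioc_of_le hT]
  exact hr.integrableOn_rate hδ measurableSet_Ioc (fun t ht => ht.1) h.meas
    (h.cont.mono Ioc_subset_Icc_self)

theorem abs_cost_le (hr : IsRegular b c C K) (hδ : 0 < δ) :
    |cost c δ α y| ≤ K / δ := by
  rw [cost, div_eq_mul_one_div, ← integral_exp_neg hδ, ← integral_const_mul, ← Real.norm_eq_abs]
  exact norm_integral_le_of_norm_le (f := rate c δ α y) ((integrableOn_exp_neg hδ).const_mul K)
    (Eventually.of_forall fun t => by exact abs_rate_le hr t)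

theorem cost_eq_add (hT : 0 ≤ T) (hint : IntegrableOn (rate c δ α y) (Ioi 0)) :
    cost c δ α y = (∫ t in (0:ℝ)..T, rate c δ α y t)
      + Real.exp (-δ * T) * cost c δ (fun t => α (t + T)) (fun t => y (t + T)) := by
  have h1 : cost c δ α y = (∫ t in Ioc 0 T, rate c δ α y t) + ∫ t in Ioi T, rate c δ α y t := by
    -- Splitting at `T` and translating the tail turns the discount into the factor `exp (-δ * T)`.
    rw [cost, ← Ioc_union_Ioi_eq_Ioi hT]
    exact setIntegral_union (Ioc_disjoint_Ioi le_rfl) measurableSet_Ioi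
      (hint.mono_set fun t ht => ht.1) (hint.mono_set (Ioi_subset_Ioi hT))
  rw [h1, intervalIntegral.integral_of_le hT]
  congr 1
  have h2 := (measurePreserving_add_right volume T).setIntegral_preimage_emb
    (measurableEmbedding_addRight T) (rate c δ α y) (Ioi T)
  rw [preimage_add_const_Ioi, sub_self] at h2
  rw [← h2, cost, ← integral_const_mul]
  congr 1
  ext t
  simp only [rate]
  rw [← mul_assoc, ← Real.exp_add]
  ring_nf

theorem cost_glue (hr : IsRegular b c C K) (hδ : 0 < δ) {α₁ α₂ : ℝ → A}
    {y₁ y₂ : ℝ → State m} (h₁ : IsArc e b x T α₁ y₁) (h₂ : IsFeasible e b (y₁ T) α₂ y₂)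
    (hT : 0 ≤ T) : cost c δ (glue T α₁ α₂) (glue T y₁ y₂)
      = (∫ t in (0:ℝ)..T, rate c δ α₁ y₁ t) + Real.exp (-δ * T) * cost c δ α₂ y₂ := by
  rw [cost_eq_add hT ((h₁.append_feasible hr h₂ hT).integrableOn_rate hr hδ)]
  congr 1
  · refine intervalIntegral.integral_congr fun t ht => ?_
    rw [uIcc_of_le hT] at ht
    simp only [rate, glue_of_le ht.2]
  · congr 1
    refine setIntegral_congr_fun measurableSet_Ioi fun t (ht : 0 < t) => ?_
    simp only [rate, glue_of_lt (show T < t + T by linarith), add_sub_cancel_right]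

/-- In `costs` the trajectory that witnesses feasibility and the one that is charged are quantified
separately; uniqueness identifies them. -/
theorem mem_costs_iff (hr : IsRegular b c C K) {J : ℝ} :
    J ∈ costs e b c δ x ↔ ∃ α y, IsFeasible e b x α y ∧ J = cost c δ α y := by
  constructor
  · rintro ⟨α, ⟨hα, y, hy, hmem⟩, y', hy', rfl⟩
    refine ⟨α, y', isFeasible_iff.2 ⟨hα, hy', fun t ht => ?_⟩, rfl⟩
    rw [← hy.unique hr hα hy' ht]
    exact hmem t ht
  · rintro ⟨α, y, h, rfl⟩
    obtain ⟨h1, h2, h3⟩ := isFeasible_iff.1 h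
    exact ⟨α, ⟨h1, y, h2, h3⟩, y, h2, rfl⟩

theorem bddBelow_costs (hr : IsRegular b c C K) (hδ : 0 < δ) : BddBelow (costs e b c δ x) := by
  refine ⟨-(K / δ), fun J hJ => ?_⟩
  obtain ⟨α, y, -, rfl⟩ := (mem_costs_iff hr).1 hJ
  exact (abs_le.1 (abs_cost_le hr hδ)).1

theorem IsFeasible.value_le (hr : IsRegular b c C K) (hδ : 0 < δ) (h : IsFeasible e b x α y) :
    value e b c δ x ≤ cost c δ α y :=
  csInf_le (bddBelow_costs hr hδ) ((mem_costs_iff hr).2 ⟨α, y, h, rfl⟩)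

theorem exists_cost_lt (hr : IsRegular b c C K) (hne : ∃ α y, IsFeasible e b x α y) {r : ℝ}
    (hlt : value e b c δ x < r) : ∃ α y, IsFeasible e b x α y ∧ cost c δ α y < r := by
  obtain ⟨α, y, h⟩ := hne
  obtain ⟨J, hJ, hJr⟩ := exists_lt_of_csInf_lt
    ⟨_, (mem_costs_iff (δ := δ) hr).2 ⟨α, y, h, rfl⟩⟩ hlt
  obtain ⟨α', y', h', rfl⟩ := (mem_costs_iff hr).1 hJ
  exact ⟨α', y', h', hJr⟩

theorem abs_value_le (hr : IsRegular b c C K) (hδ : 0 < δ)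
    (hne : ∃ α y, IsFeasible e b x α y) : |value e b c δ x| ≤ K / δ := by
  obtain ⟨α, y, h⟩ := hne
  refine abs_le.2 ⟨?_, (h.value_le hr hδ).trans (abs_le.1 (abs_cost_le hr hδ)).2⟩
  refine le_csInf ⟨_, (mem_costs_iff hr).2 ⟨α, y, h, rfl⟩⟩ fun J hJ => ?_
  obtain ⟨α, y, -, rfl⟩ := (mem_costs_iff hr).1 hJ
  exact (abs_le.1 (abs_cost_le hr hδ)).1

/-- Dynamic programming, upper inequality. -/
theorem IsArc.value_le (hr : IsRegular b c C K) (hδ : 0 < δ)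
    (hne : ∀ x ∈ network e, ∃ α y, IsFeasible e b x α y)
    (h : IsArc e b x T α y) (hT : 0 ≤ T) :
    value e b c δ x ≤ (∫ t in (0:ℝ)..T, rate c δ α y t)
      + Real.exp (-δ * T) * value e b c δ (y T) := by
  refine le_of_forall_pos_le_add fun ε hε => ?_
  obtain ⟨α', y', h', hlt⟩ := exists_cost_lt (δ := δ) hr (hne _ (h.mem T ⟨hT, le_rfl⟩))
    (lt_add_of_pos_right _ hε)
  have h1 := (h.append_feasible hr h' hT).value_le hr hδ
  rw [cost_glue hr hδ h h' hT] at h1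
  have h2 : Real.exp (-δ * T) ≤ 1 := Real.exp_le_one_iff.2 (by nlinarith)
  have h3 := Real.exp_pos (-δ * T)
  nlinarith

theorem abs_integral_rate_le (hr : IsRegular b c C K) (hδ : 0 < δ) (hT : 0 ≤ T) :
    |∫ t in (0:ℝ)..T, rate c δ α y t| ≤ K * T := by
  have := intervalIntegral.norm_integral_le_of_norm_le_const (a := 0) (b := T)
    (f := rate c δ α y) (C := K) (fun t ht => by
      rw [uIoc_of_le hT] at ht
      refine (abs_rate_le hr t).trans ?_
      have : Real.exp (-δ * t) ≤ 1 := Real.exp_le_one_iff.2 (by nlinarith [ht.1])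
      nlinarith [hr.K_pos])
  rwa [sub_zero, abs_of_nonneg hT] at this

/-- The value cannot drop much along a short arc. -/
theorem IsArc.value_le_add (hr : IsRegular b c C K) (hδ : 0 < δ)
    (hne : ∀ x ∈ network e, ∃ α y, IsFeasible e b x α y)
    (h : IsArc e b x T α y) (hT : 0 ≤ T) :
    value e b c δ x ≤ value e b c δ (y T) + 2 * K * T := by
  have h1 := h.value_le hr hδ hne hT
  have h2 := (abs_le.1 (abs_integral_rate_le (α := α) (y := y) hr hδ hT)).2
  have h3 := (abs_le.1 (abs_value_le hr hδ (hne _ (h.mem T ⟨hT, le_rfl⟩)))).1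
  have h4 : 1 - δ * T ≤ Real.exp (-δ * T) := by
    have := Real.add_one_le_exp (-δ * T); linarith
  have h5 : Real.exp (-δ * T) ≤ 1 := Real.exp_le_one_iff.2 (by nlinarith)
  -- Of the constant `2 * K`, one `K` pays for the running cost and the other for the discount,
  -- since `1 - exp (-δ * T) ≤ δ * T` and the value is at least `-(K / δ)`.
  have h6 : (1 - Real.exp (-δ * T)) * -value e b c δ (y T) ≤ δ * T * (K / δ) := by
    have hk : 0 ≤ K / δ := div_nonneg hr.K_pos.le hδ.le
    calc (1 - Real.exp (-δ * T)) * -value e b c δ (y T)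
        ≤ (1 - Real.exp (-δ * T)) * (K / δ) := by
          apply mul_le_mul_of_nonneg_left <;> linarith
      _ ≤ _ := by apply mul_le_mul_of_nonneg_right _ hk; linarith
  have h7 : δ * T * (K / δ) = K * T := by field_simp
  nlinarith

/-- Comparison of a feasible pair with an arc from another point, up to a common time. -/
theorem IsArc.value_le_of_close (hr : IsRegular b c C K) (hδ : 0 < δ)
    (hne : ∀ x ∈ network e, ∃ α y, IsFeasible e b x α y)
    (h : IsFeasible e b x α y) {α' : ℝ → A} {y' : ℝ → State m}
    (h' : IsArc e b z T α' y') (hT : 0 ≤ T) {κ ε : ℝ} (hκ : 0 ≤ κ)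
    (hc : ∀ᵐ t, t ∈ Icc 0 T → c (y' t) (α' t) - c (y t) (α t) ≤ κ)
    (hend : Real.exp (-δ * T) * (value e b c δ (y' T) - value e b c δ (y T)) ≤ ε) :
    value e b c δ z ≤ cost c δ α y + κ / δ + ε := by
  -- Dynamic programming bounds the value at `z` along the arc, while the tail of the feasible pair
  -- costs at least the value at `y T`. What remains is the difference of running costs, at most `∫
  -- κ * exp (-δ * t) = κ / δ`.
  have h1 := h'.value_le hr hδ hne hT
  have h2 := (h.shift hr hT).value_le hr hδ
  rw [cost_eq_add hT (h.integrableOn_rate hr hδ)]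
  have h3 : (∫ t in (0:ℝ)..T, rate c δ α' y' t) - (∫ t in (0:ℝ)..T, rate c δ α y t) ≤ κ / δ := by
    have i1 := h'.intervalIntegrable_rate hr hδ hT
    have i2 := (h T hT).intervalIntegrable_rate hr hδ hT
    rw [← intervalIntegral.integral_sub i1 i2, intervalIntegral.integral_of_le hT]
    have hsub : Ioc (0:ℝ) T ⊆ Ioi 0 := fun t ht => ht.1
    calc ∫ t in Ioc 0 T, (rate c δ α' y' t - rate c δ α y t)
        ≤ ∫ t in Ioc 0 T, κ * Real.exp (-δ * t) := by
          refine integral_mono_ae (i1.1.sub i2.1)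
            (((integrableOn_exp_neg hδ).mono_set hsub).const_mul κ) ?_
          rw [EventuallyLE, ae_restrict_iff' measurableSet_Ioc]
          filter_upwards [hc] with t ht htm
          have := ht (Ioc_subset_Icc_self htm)
          simp only [rate]
          have h3 := Real.exp_pos (-δ * t)
          nlinarith
      _ ≤ ∫ t in Ioi 0, κ * Real.exp (-δ * t) := by
          refine setIntegral_mono_set ((integrableOn_exp_neg hδ).const_mul κ)
            (Eventually.of_forall fun t => by positivity) (LE.le.eventuallyLE hsub)
      _ = κ / δ := by rw [integral_const_mul, integral_exp_neg hδ]; ring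
  have h4 := mul_le_mul_of_nonneg_left h2 (Real.exp_pos (-δ * T)).le
  rw [mul_sub] at hend
  linarith

end

/-! ## Roads -/

section

variable {m N : ℕ} {A : Type*} [MetricSpace A] [CompactSpace A] [MeasurableSpace A] [BorelSpace A]

variable {e : Fin N → State m} {b : State m → A → State m} {c : State m → A → ℝ}
  {C K δ : ℝ} {x z : State m} {T : ℝ} {α : ℝ → A} {y : ℝ → State m} {j : Fin N}

/-! ### Roads -/

/-- The closed road `[0,1] e_j`. -/
def closedRoad (e : Fin N → State m) (j : Fin N) : Set (State m) :=
  (fun r : ℝ => r • e j) '' Icc 0 1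

theorem isCompact_closedRoad : IsCompact (closedRoad e j) :=
  isCompact_Icc.image (by fun_prop)

theorem closedRoad_subset : closedRoad e j ⊆ network e := subset_iUnion (closedRoad e) j

theorem isCompact_network : IsCompact (network e) := isCompact_iUnion fun _ => isCompact_closedRoad

theorem ne_zero_of_sameRay (hN : 2 ≤ N) (he : ∀ i j, i ≠ j → ¬ SameRay ℝ (e i) (e j)) (j : Fin N) :
    e j ≠ 0 := by
  intro h0
  have : Nontrivial (Fin N) := Fin.nontrivial_iff_two_le.2 hN
  obtain ⟨i, hi⟩ := exists_ne j
  exact he j i hi.symm (Or.inl h0)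

theorem eq_zero_of_mem_closedRoad (he : ∀ i j, i ≠ j → ¬ SameRay ℝ (e i) (e j)) {i : Fin N}
    (hij : i ≠ j) (hi : x ∈ closedRoad e i) (hj : x ∈ closedRoad e j) : x = 0 := by
  obtain ⟨r, hr, rfl⟩ := hi
  obtain ⟨s, hs, hrs⟩ := hj
  simp only at hrs ⊢
  rcases hr.1.eq_or_lt with h | h
  · simp [← h]
  rcases hs.1.eq_or_lt with h' | h'
  · rw [← hrs, ← h', zero_smul]
  · exact absurd (Or.inr (Or.inr ⟨r, s, h, h', hrs.symm⟩)) (he i j hij)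

/-- The coordinate along the vector `v`. -/
noncomputable def coord (v : State m) : State m →L[ℝ] ℝ := (‖v‖ ^ 2)⁻¹ • innerSL ℝ v

theorem coord_apply (v p : State m) : coord v p = ⟪p, v⟫ / ‖v‖ ^ 2 := by
  rw [coord, _root_.smul_apply, innerSL_apply_apply, real_inner_comm, smul_eq_mul]
  ring

theorem coord_smul {v : State m} (hv : v ≠ 0) (r : ℝ) : coord v (r • v) = r := by
  have : ‖v‖ ≠ 0 := norm_ne_zero_iff.2 hv
  rw [coord_apply, real_inner_smul_left, real_inner_self_eq_norm_sq]
  field_simp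

theorem coord_mem (hv : e j ≠ 0) (hx : x ∈ closedRoad e j) :
    coord (e j) x ∈ Icc (0:ℝ) 1 ∧ coord (e j) x • e j = x := by
  obtain ⟨r, hr, rfl⟩ := hx
  simp only [coord_smul hv]
  exact ⟨hr, trivial⟩

theorem abs_coord_le {v : State m} (hv : v ≠ 0) (p : State m) : |coord v p| ≤ ‖p‖ / ‖v‖ := by
  have : 0 < ‖v‖ := norm_pos_iff.2 hv
  rw [coord_apply, abs_div, abs_of_nonneg (by positivity : 0 ≤ ‖v‖ ^ 2), div_le_div_iff₀
    (by positivity) this]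
  have := abs_real_inner_le_norm p v
  calc |⟪p, v⟫| * ‖v‖ ≤ ‖p‖ * ‖v‖ * ‖v‖ := by gcongr
    _ = _ := by ring

/-- Truncation to `[0,1]`. -/
noncomputable def clamp (r : ℝ) : ℝ := max 0 (min 1 r)

theorem clamp_of_mem {r : ℝ} (h : r ∈ Icc (0:ℝ) 1) : clamp r = r := by
  rw [clamp, min_eq_right h.2, max_eq_right h.1]

theorem clamp_mono {r s : ℝ} (h : s ≤ r) : clamp s ≤ clamp r :=
  max_le_max le_rfl (min_le_min le_rfl h)

theorem clamp_sub_le {r s : ℝ} (h : s ≤ r) : clamp r - clamp s ≤ r - s := by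
  simp only [clamp]
  rcases max_cases 0 (min 1 r) with h1 | h1 <;> rcases max_cases 0 (min 1 s) with h2 | h2 <;>
  rcases min_cases 1 r with h3 | h3 <;> rcases min_cases 1 s with h4 | h4 <;> linarith

theorem uniformContinuous_clamp : UniformContinuous clamp := by
  have : LipschitzWith 1 clamp := by
    refine LipschitzWith.of_le_add fun r s => ?_
    rw [Real.dist_eq]
    rcases le_total s r with h | h
    · linarith [clamp_sub_le h, le_abs_self (r - s)]
    · linarith [clamp_mono h, abs_nonneg (r - s)]
  exact this.uniformContinuous

/-- The scalar velocity along the road directed by `v`, extended to all real positions. -/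
noncomputable def speed (v : State m) (b : State m → A → State m) (r : ℝ) (a : A) : ℝ :=
  coord v (b (clamp r • v) a)

theorem IsRegular.uniformContinuous_speed (hr : IsRegular b c C K) (v : State m) :
    UniformContinuous fun p : ℝ × A => speed v b p.1 p.2 := by
  have h1 : UniformContinuous fun p : ℝ × A => ((clamp p.1 • v, p.2) : State m × A) := by
    refine UniformContinuous.prodMk ?_ uniformContinuous_snd
    exact ((ContinuousLinearMap.id ℝ ℝ).smulRight v).uniformContinuous.comp
      (uniformContinuous_clamp.comp uniformContinuous_fst)
  exact (coord v).uniformContinuous.comp (hr.unif.comp h1)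

theorem IsRegular.abs_speed_le (hr : IsRegular b c C K) {v : State m} (hv : v ≠ 0) (r : ℝ) (a : A) :
    |speed v b r a| ≤ C / ‖v‖ := by
  refine (abs_coord_le hv _).trans ?_
  gcongr
  exact hr.bound _ _

/-- Clamping is monotone and 1-Lipschitz, so it preserves the one-sided bound; this lets the scalar
equation be solved on the whole line before it is known whether its solution stays in `[0,1]`. -/
theorem IsRegular.speed_sub_le (hr : IsRegular b c C K) {v : State m} (hv : v ≠ 0) {r s : ℝ}
    (h : s ≤ r) (a : A) : speed v b r a - speed v b s a ≤ C * (r - s) := by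
  have hv' : 0 < ‖v‖ := norm_pos_iff.2 hv
  have hC := hr.C_pos
  rcases (clamp_mono h).eq_or_lt with heq | hlt
  · simp only [speed, heq, sub_self]
    exact mul_nonneg hC.le (by linarith)
  have h1 := hr.oneSided (clamp r • v) (clamp s • v) a
  rw [← sub_smul, norm_smul, Real.norm_of_nonneg (by linarith), inner_smul_right] at h1
  have h2 : speed v b r a - speed v b s a ≤ C * (clamp r - clamp s) := by
    rw [speed, speed, ← map_sub, coord_apply, div_le_iff₀ (by positivity)]
    refine le_of_mul_le_mul_left ?_ (sub_pos.2 hlt)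
    linarith
  exact h2.trans (mul_le_mul_of_nonneg_left (clamp_sub_le h) hC.le)

/-! ### Tangency -/

theorem IsTrajectory.hasDerivWithinAt (hr : IsRegular b c C K) {a : A}
    (h : IsTrajectory b x (fun _ => a) y) : HasDerivWithinAt y (b x a) (Ici 0) 0 := by
  have h0 : y 0 = x := by simpa using h.2 0 le_rfl
  have hb : Continuous fun p => b p a :=
    hr.unif.continuous.comp (continuous_id.prodMk continuous_const)
  have hc : ContinuousOn (fun s => b (y s) a) (Ici 0) := hb.comp_continuousOn h.1
  have h1 : HasDerivWithinAt (fun u => ∫ s in (0:ℝ)..u, b (y s) a) (b (y 0) a) (Ici 0) 0 := by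
    refine intervalIntegral.integral_hasDerivWithinAt_right (s := Ici 0) (t := Ioi 0)
      (by simp) ?_ ?_
    · exact (hc.mono Ioi_subset_Ici_self).stronglyMeasurableAtFilter_nhdsWithin
        measurableSet_Ioi 0
    · exact (hc 0 self_mem_Ici).mono Ioi_subset_Ici_self
  rw [h0] at h1
  exact (h1.const_add x).congr (fun t ht => h.2 t ht) (h.2 0 le_rfl)

theorem eventually_mem_closedRoad (he : ∀ i j, i ≠ j → ¬ SameRay ℝ (e i) (e j))
    (hx : x ∈ closedRoad e j) (hx0 : x ≠ 0) : ∀ᶠ p in 𝓝 x, p ∈ network e → p ∈ closedRoad e j := by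
  have hcl : IsClosed (⋃ i ∈ ({i | i ≠ j} : Set (Fin N)), closedRoad e i) :=
    (Set.toFinite _).isClosed_biUnion fun i _ => isCompact_closedRoad.isClosed
  have hnot : x ∉ ⋃ i ∈ ({i | i ≠ j} : Set (Fin N)), closedRoad e i := by
    simp only [mem_iUnion, not_exists]
    intro i hi hxi
    exact hx0 (eq_zero_of_mem_closedRoad he hi hxi hx)
  filter_upwards [hcl.isOpen_compl.mem_nhds hnot] with p hp hpn
  obtain ⟨i, hi⟩ := mem_iUnion.1 hpn
  by_contra hpj
  refine hp (mem_biUnion (show i ∈ {i | i ≠ j} from ?_) hi)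
  rintro rfl
  exact hpj hi

/-- The controls of a road are tangent to the road, including its end points. -/
theorem tangent (hr : IsRegular b c C K) (hv : e j ≠ 0)
    (he : ∀ i j, i ≠ j → ¬ SameRay ℝ (e i) (e j)) {a : A}
    (ha : ∀ x ∈ road e j, a ∈ localControls e b x) {r : ℝ} (hr01 : r ∈ Icc (0:ℝ) 1) :
    b (r • e j) a = speed (e j) b r a • e j := by
  -- `P` removes the component along `e j` and vanishes on the closed road. A locally admissible
  -- trajectory starting inside the road stays on it for a while, so the derivative of `P (y t)` at
  -- `0` is zero; continuity extends the result to the end points.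
  set P : State m →L[ℝ] State m :=
    ContinuousLinearMap.id ℝ _ - (coord (e j)).smulRight (e j) with hP
  have hPapp : ∀ p, P p = p - coord (e j) p • e j := fun p => by simp [hP]
  have hPr : ∀ p ∈ closedRoad e j, P p = 0 := fun p hp => by
    rw [hPapp, (coord_mem hv hp).2, sub_self]
  suffices h : P (b (r • e j) a) = 0 by
    rw [hPapp, sub_eq_zero] at h
    rw [speed, clamp_of_mem hr01]
    exact h
  have hcl : IsClosed {r : ℝ | P (b (r • e j) a) = 0} := by
    have h1 : Continuous fun r : ℝ => b (r • e j) a :=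
      hr.unif.continuous.comp (by fun_prop : Continuous fun r : ℝ => ((r • e j, a) : State m × A))
    exact isClosed_eq (P.continuous.comp h1) continuous_const
  have hsub : Ioo (0:ℝ) 1 ⊆ {r : ℝ | P (b (r • e j) a) = 0} := by
    intro s hs
    obtain ⟨y, hy, θ, hθ, hyn⟩ := ha (s • e j) ⟨s, hs, rfl⟩
    have h0 : y 0 = s • e j := by simpa using hy.2 0 le_rfl
    have hev : ∀ᶠ t in 𝓝[≥] (0:ℝ), P (y t) = 0 := by
      have h1 := eventually_mem_closedRoad he (x := s • e j) ⟨s, ⟨hs.1.le, hs.2.le⟩, rfl⟩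
        (smul_ne_zero hs.1.ne' hv)
      have h2 : Tendsto y (𝓝[≥] 0) (𝓝 (s • e j)) := by
        rw [← h0]; exact hy.1 0 self_mem_Ici
      filter_upwards [h2.eventually h1, Icc_mem_nhdsGE hθ] with t ht1 ht2
      exact hPr _ (ht1 (hyn t ht2))
    have hd : HasDerivWithinAt (fun t => P (y t)) (P (b (s • e j) a)) (Ici 0) 0 :=
      P.hasFDerivAt.comp_hasDerivWithinAt (0:ℝ) (hy.hasDerivWithinAt hr)
    have hd0 : HasDerivWithinAt (fun t => P (y t)) 0 (Ici 0) 0 :=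
      (hasDerivWithinAt_const (0:ℝ) (Ici 0) (0 : State m)).congr_of_eventuallyEq hev
        (by rw [h0]; exact hPr _ ⟨s, ⟨hs.1.le, hs.2.le⟩, rfl⟩)
    exact (uniqueDiffWithinAt_Ici (0:ℝ)).eq_deriv _ hd hd0
  have := closure_minimal hsub hcl
  rw [closure_Ioo (zero_ne_one' ℝ)] at this
  exact this hr01

theorem mem_of_mem_Ico {X : Type*} [TopologicalSpace X] {q : ℝ → X} {S : Set X} {τ : ℝ}
    (hS : IsClosed S) (hq : ContinuousOn q (Icc 0 τ)) (h0 : q 0 ∈ S)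
    (h : ∀ t ∈ Ico 0 τ, q t ∈ S) : ∀ t ∈ Icc 0 τ, q t ∈ S := by
  intro t ht
  rcases ht.2.lt_or_eq with hlt | rfl
  · exact h t ⟨ht.1, hlt⟩
  rcases ht.1.eq_or_lt with h0' | hpos
  · rwa [← h0']
  · have hcw : ContinuousWithinAt q (Ico 0 t) t := (hq t ht).mono Ico_subset_Icc_self
    have hcl : t ∈ closure (Ico 0 t) := by rw [closure_Ico hpos.ne]; exact ht
    have hsub : q '' Ico 0 t ⊆ S := image_subset_iff.2 h
    exact closure_minimal hsub hS (hcw.mem_closure_image hcl)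

/-! ### Trajectories on a road -/

/-- A trajectory of the network that does not meet the intersection stays on its road. -/
theorem IsArc.mem_closedRoad (he : ∀ i j, i ≠ j → ¬ SameRay ℝ (e i) (e j))
    (h : IsArc e b x T α y) (hx : x ∈ closedRoad e j) (hne : ∀ t ∈ Ico 0 T, y t ≠ 0) :
    ∀ t ∈ Icc 0 T, y t ∈ closedRoad e j := by
  have main : ∀ t ∈ Ico 0 T, y t ∈ closedRoad e j := by
    intro t ht
    by_contra hcon
    have h0 : y 0 = x := h.zero (ht.1.trans ht.2.le)
    -- The connected image of `[0, t]` is covered by two closed sets, road `j` and the other roads,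
    -- which meet only at the intersection.
    set F := ⋃ i ∈ ({i | i ≠ j} : Set (Fin N)), closedRoad e i with hF
    have hcl : IsClosed F := (Set.toFinite _).isClosed_biUnion fun i _ =>
      isCompact_closedRoad.isClosed
    have hsub : Icc 0 t ⊆ Icc 0 T := Icc_subset_Icc_right ht.2.le
    have hpre : IsPreconnected (y '' Icc 0 t) := isPreconnected_Icc.image y (h.cont.mono hsub)
    have hmem : ∀ s ∈ Icc 0 t, y s ∈ closedRoad e j ∪ F := by
      intro s hs
      obtain ⟨i, hi⟩ := mem_iUnion.1 (h.mem s (hsub hs))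
      by_cases hij : i = j
      · exact Or.inl (hij ▸ hi)
      · exact Or.inr (mem_biUnion (show i ∈ {i | i ≠ j} from hij) hi)
    obtain ⟨p, ⟨s, hs, rfl⟩, hp1, hp2⟩ := isPreconnected_closed_iff.1 hpre (closedRoad e j) F
      isCompact_closedRoad.isClosed hcl (by rintro _ ⟨s, hs, rfl⟩; exact hmem s hs)
      ⟨y 0, ⟨0, ⟨le_rfl, ht.1⟩, rfl⟩, h0 ▸ hx⟩
      ⟨y t, ⟨t, ⟨ht.1, le_rfl⟩, rfl⟩, (hmem t ⟨ht.1, le_rfl⟩).resolve_left hcon⟩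
    simp only [hF, mem_iUnion] at hp2
    obtain ⟨i, hi, hpi⟩ := hp2
    exact hne s ⟨hs.1, hs.2.trans_lt ht.2⟩ (eq_zero_of_mem_closedRoad he hi hpi hp1)
  intro t ht
  refine mem_of_mem_Ico isCompact_closedRoad.isClosed h.cont ?_ main t ht
  rwa [h.zero (ht.1.trans ht.2)]

/-- The lengths `θ` have no lower bound, so one cannot march forward in time. Instead countably many
of the intervals have the same union, and the points of `S` outside it are left ends of pairwise
disjoint open intervals, hence countable. -/
theorem ae_of_right_local {P : ℝ → Prop} {S : Set ℝ}
    (h : ∀ t ∈ S, ∃ θ > 0, ∀ᵐ s, s ∈ Ioo t (t + θ) → P s) : ∀ᵐ s, s ∈ S → P s := by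
  choose! θ hθ hP using h
  obtain ⟨I, hIS, hI, hU⟩ := TopologicalSpace.isOpen_biUnion_countable S
    (fun t => Ioo t (t + θ t)) (fun _ _ => isOpen_Ioo)
  have hcount : (S \ ⋃ t ∈ S, Ioo t (t + θ t)).Countable := by
    refine PairwiseDisjoint.countable_of_Ioo (y := fun t => t + θ t) ?_
      (fun t ht => lt_add_of_pos_right _ (hθ t ht.1))
    intro s hs t ht hst
    simp only [Function.onFun]
    wlog hlt : s < t generalizing s t
    · exact (this ht hs hst.symm (lt_of_le_of_ne (not_lt.1 hlt) hst.symm)).symm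
    have : s + θ s ≤ t := by
      by_contra hcon
      exact ht.2 (mem_biUnion hs.1 ⟨hlt, not_le.1 hcon⟩)
    exact Set.disjoint_left.2 fun u hu hu' => by linarith [hu.2, hu'.1]
  have h1 : ∀ᵐ s, ∀ t ∈ I, s ∈ Ioo t (t + θ t) → P s :=
    (ae_ball_iff hI).2 fun t ht => hP t (hIS ht)
  have h2 : ∀ᵐ s : ℝ, s ∉ S \ ⋃ t ∈ S, Ioo t (t + θ t) :=
    compl_mem_ae_iff.2 (hcount.measure_zero volume)
  filter_upwards [h1, h2] with s hs1 hs2 hsS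
  have : s ∈ ⋃ t ∈ I, Ioo t (t + θ t) := by
    rw [hU]
    by_contra hcon
    exact hs2 ⟨hsS, hcon⟩
  simp only [mem_iUnion] at this
  obtain ⟨t, ht, hst⟩ := this
  exact hs1 t ht hst

/-- The velocity vanishes at almost every time spent at a given point. -/
theorem IsArc.ae_velocity_eq_zero (hr : IsRegular b c C K) (h : IsArc e b x T α y) (hT : 0 ≤ T)
    (p : State m) : ∀ᵐ t, t ∈ Ioo 0 T → y t = p → b p (α t) = 0 := by
  have hi := hr.intervalIntegrable h.meas hT h.cont
  -- Only countably many visits to `p` are isolated from the right. At any other visit, the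
  -- difference quotients along later visits are zero, while at almost every time their limit is the
  -- velocity.
  have hcount := countable_setOfPred_isolated_right_within (s := {t | t ∈ Ioo 0 T ∧ y t = p})
  have h1 : ∀ᵐ t : ℝ, t ∉ {t ∈ {t | t ∈ Ioo 0 T ∧ y t = p} |
      𝓝[{t | t ∈ Ioo 0 T ∧ y t = p} ∩ Ioi t] t = ⊥} :=
    compl_mem_ae_iff.2 (hcount.measure_zero volume)
  filter_upwards [hi.ae_hasDerivAt_integral, h1] with t hd ht htT hyt
  set S := {t | t ∈ Ioo 0 T ∧ y t = p} ∩ Ioi t with hS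
  have hne : (𝓝[S] t).NeBot := ⟨fun hbot => ht ⟨⟨htT, hyt⟩, hbot⟩⟩
  rw [uIcc_of_le hT] at hd
  have hd' := ((hd ⟨htT.1.le, htT.2.le⟩ 0 ⟨le_rfl, hT⟩).hasDerivWithinAt (s := S))
  rw [hasDerivWithinAt_iff_tendsto_slope, sdiff_singleton_eq_self
    (show t ∉ S from fun hmem => lt_irrefl t (show t < t from hmem.2)), hyt] at hd'
  refine tendsto_nhds_unique hd' (tendsto_const_nhds.congr' ?_)
  filter_upwards [self_mem_nhdsWithin] with s hs
  have e1 := h.eq s ⟨hs.1.1.1.le, hs.1.1.2.le⟩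
  have e2 := h.eq t ⟨htT.1.le, htT.2.le⟩
  rw [hs.1.2] at e1
  rw [hyt] at e2
  have : ∫ s in (0:ℝ)..s, b (y s) (α s) = ∫ s in (0:ℝ)..t, b (y s) (α s) :=
    add_left_cancel (e1.symm.trans e2)
  rw [slope_def_module, this, sub_self, smul_zero]

/-- On its road, a feasible control takes its values in the controls of the road. -/
theorem IsFeasible.ae_mem (hr : IsRegular b c C K) {B : Set A}
    (hvertex : localControls e b (e j) ⊆ B)
    (hroad : ∀ x ∈ road e j, ∃ θ : ℝ, 0 < θ ∧
      ∀ α ∈ feasibleControls e b x, ∀ᵐ t ∂(volume.restrict (Icc (0 : ℝ) θ)), α t ∈ B)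
    (h : IsFeasible e b x α y) (hT : 0 ≤ T) (hy : ∀ t ∈ Icc 0 T, y t ∈ closedRoad e j)
    (hne : ∀ t ∈ Ico 0 T, y t ≠ 0) : ∀ᵐ t, t ∈ Icc 0 T → α t ∈ B := by
  have h1 : ∀ᵐ t, t ∈ {t | 0 ≤ t ∧ y t ∈ road e j} → α t ∈ B := by
    refine ae_of_right_local fun t ht => ?_
    obtain ⟨θ, hθ, hB⟩ := hroad _ ht.2
    refine ⟨θ, hθ, ?_⟩
    obtain ⟨g1, g2, g3⟩ := isFeasible_iff.1 (h.shift hr ht.1)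
    have h2 := hB _ ⟨g1, _, g2, g3⟩
    rw [ae_restrict_iff' measurableSet_Icc] at h2
    filter_upwards [(measurePreserving_sub_right volume t).quasiMeasurePreserving.ae h2]
      with s hs hst
    have := hs ⟨by linarith [hst.1], by linarith [hst.2]⟩
    rwa [sub_add_cancel] at this
  have h2 : ∀ᵐ t : ℝ, t ≠ 0 := by simp [ae_iff]
  have h3 : ∀ᵐ t : ℝ, t ≠ T := by simp [ae_iff]
  filter_upwards [h1, h2, h3, (h T hT).ae_velocity_eq_zero hr hT (e j)] with t g1 g2 g3 g4 ht
  have htI : t ∈ Ioo 0 T := ⟨lt_of_le_of_ne ht.1 g2.symm, lt_of_le_of_ne ht.2 g3⟩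
  obtain ⟨r, hr01, hry⟩ := hy t ht
  simp only at hry
  rcases hr01.1.eq_or_lt with h0 | h0
  · exact absurd (by rw [← hry, ← h0, zero_smul]) (hne t ⟨ht.1, htI.2⟩)
  rcases hr01.2.eq_or_lt with h1' | h1'
  · rw [h1', one_smul] at hry
    have hz := g4 htI hry.symm
    -- Zero velocity at the vertex means that the constant control `α t` keeps the state there, so
    -- it is locally admissible.
    refine hvertex ⟨fun _ => e j, ⟨continuousOn_const, fun s hs => ?_⟩, 1, one_pos, fun s _ => ?_⟩
    · simp [hz]
    · exact closedRoad_subset (j := j) ⟨1, ⟨zero_le_one, le_rfl⟩, one_smul _ _⟩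
  · exact g1 ⟨ht.1, r, ⟨h0, h1'⟩, hry⟩

theorem IsArc.coord_eq (hr : IsRegular b c C K) (hv : e j ≠ 0) (h : IsArc e b x T α y)
    (hT : 0 ≤ T) (hy : ∀ t ∈ Icc 0 T, y t ∈ closedRoad e j) :
    ∀ t ∈ Icc 0 T, coord (e j) (y t)
      = coord (e j) x + ∫ s in (0:ℝ)..t, speed (e j) b (coord (e j) (y s)) (α s) := by
  intro t ht
  have hi := intervalIntegrable_sub (hr.intervalIntegrable h.meas hT h.cont) le_rfl ht.1 ht.2
  have h1 := (coord (e j)).intervalIntegral_comp_comm hi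
  rw [h.eq t ht, map_add, ← h1]
  congr 1
  refine intervalIntegral.integral_congr fun s hs => ?_
  rw [uIcc_of_le ht.1] at hs
  have hs' := coord_mem hv (hy s ⟨hs.1, hs.2.trans ht.2⟩)
  simp only [speed, clamp_of_mem hs'.1, hs'.2]

/-- A solution of the scalar equation that stays in `[0,1]` gives a trajectory on the road. -/
theorem isArc_of_scalar {B : Set A}
    (htan : ∀ a ∈ B, ∀ r ∈ Icc (0:ℝ) 1, b (r • e j) a = speed (e j) b r a • e j)
    {q : ℝ → ℝ} {r : ℝ} (hα : Measurable α) (hB : ∀ᵐ t, t ∈ Icc 0 T → α t ∈ B)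
    (hqc : ContinuousOn q (Icc 0 T))
    (hq : ∀ t ∈ Icc 0 T, q t = r + ∫ s in (0:ℝ)..t, speed (e j) b (q s) (α s))
    (hq01 : ∀ t ∈ Icc 0 T, q t ∈ Icc (0:ℝ) 1) :
    IsArc e b (r • e j) T α (fun t => q t • e j) := by
  refine ⟨hα, hqc.smul continuousOn_const, fun t ht => ?_, fun t ht =>
    closedRoad_subset (j := j) ⟨q t, hq01 t ht, rfl⟩⟩
  rw [hq t ht, add_smul, ← intervalIntegral.integral_smul_const]
  congr 1
  refine intervalIntegral.integral_congr_ae ?_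
  filter_upwards [hB] with s hs hst
  rw [uIoc_of_le ht.1] at hst
  have hs' : s ∈ Icc 0 T := ⟨hst.1.le, hst.2.trans ht.2⟩
  exact (htan _ (hs hs') _ (hq01 s hs')).symm

end

/-! ## Moving along a road -/

section

variable {m N : ℕ} {A : Type*} [MetricSpace A] [CompactSpace A] [MeasurableSpace A] [BorelSpace A]

variable {e : Fin N → State m} {b : State m → A → State m} {c : State m → A → ℝ}
  {C K δ : ℝ} {x z : State m} {T : ℝ} {α : ℝ → A} {y : ℝ → State m} {j : Fin N}

/-! ### Comparison of scalar solutions -/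

theorem IsRegular.intervalIntegrable_speed (hr : IsRegular b c C K) {v : State m} (hv : v ≠ 0)
    (hα : Measurable α) (hT : 0 ≤ T) {q : ℝ → ℝ} (hq : ContinuousOn q (Icc 0 T)) :
    IntervalIntegrable (fun s => speed v b (q s) (α s)) volume 0 T :=
  intervalIntegrable_of_bound hT
    (aestronglyMeasurable_comp_pair (hr.uniformContinuous_speed v).continuous hα
      measurableSet_Ioc (hq.mono Ioc_subset_Icc_self)) (fun _ => hr.abs_speed_le hv _ _)

/-- If no control moves away from the level `ρ`, a solution starting below `ρ` stays below `ρ`. -/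
theorem IsRegular.le_of_speed_nonpos (hr : IsRegular b c C K) {v : State m} (hv : v ≠ 0)
    (hα : Measurable α) (hT : 0 ≤ T) {q : ℝ → ℝ} {r ρ : ℝ} (hqc : ContinuousOn q (Icc 0 T))
    (hq : ∀ t ∈ Icc 0 T, q t = r + ∫ s in (0:ℝ)..t, speed v b (q s) (α s)) (hrρ : r ≤ ρ)
    (hneg : ∀ᵐ t, t ∈ Icc 0 T → speed v b ρ (α t) ≤ 0) : ∀ t ∈ Icc 0 T, q t ≤ ρ := by
  intro t ht
  have hq0 : q 0 = r := by simpa using hq 0 ⟨le_rfl, hT⟩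
  have := le_gronwallBound_of_pos (u := fun t => q t - ρ) hr.C_pos.le le_rfl
    (hqc.sub continuousOn_const) (hr.intervalIntegrable_speed hv hα hT hqc)
    (fun s hs => by rw [hq s hs, hq0]; ring) ?_ t ht
  · rw [max_eq_right (by rw [hq0]; linarith), gronwallBound_ε0_δ0] at this
    linarith
  · filter_upwards [hneg] with s hs hsT hpos
    have h1 := hs hsT
    have h2 := hr.speed_sub_le hv (sub_pos.1 hpos).le (α s)
    linarith

/-- Only one sign is estimated, because the velocity bound is one-sided; exchanging the solutions
gives the other. -/
theorem IsRegular.sub_le_of_speed (hr : IsRegular b c C K) {v : State m} (hv : v ≠ 0)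
    (hα : Measurable α) (hT : 0 ≤ T) {q p : ℝ → ℝ} {r s : ℝ} (hqc : ContinuousOn q (Icc 0 T))
    (hpc : ContinuousOn p (Icc 0 T))
    (hq : ∀ t ∈ Icc 0 T, q t = r + ∫ s in (0:ℝ)..t, speed v b (q s) (α s))
    (hp : ∀ t ∈ Icc 0 T, p t = s + ∫ s in (0:ℝ)..t, speed v b (p s) (α s)) :
    ∀ t ∈ Icc 0 T, q t - p t ≤ |r - s| * Real.exp (C * t) := by
  intro t ht
  have hq0 : q 0 = r := by simpa using hq 0 ⟨le_rfl, hT⟩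
  have hp0 : p 0 = s := by simpa using hp 0 ⟨le_rfl, hT⟩
  have hi := hr.intervalIntegrable_speed hv hα hT hqc
  have hi' := hr.intervalIntegrable_speed hv hα hT hpc
  have := le_gronwallBound_of_pos (u := fun t => q t - p t) hr.C_pos.le le_rfl
    (hqc.sub hpc) (hi.sub hi') (fun τ hτ => by
      rw [intervalIntegral.integral_sub (intervalIntegrable_sub hi le_rfl hτ.1 hτ.2)
        (intervalIntegrable_sub hi' le_rfl hτ.1 hτ.2), hq τ hτ, hp τ hτ, hq0, hp0]
      ring) (Eventually.of_forall fun τ _ hpos => by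
        have h2 := hr.speed_sub_le hv (sub_pos.1 hpos).le (α τ)
        linarith) t ht
  rw [gronwallBound_ε0, hq0, hp0] at this
  refine this.trans ?_
  gcongr
  exact max_le (le_abs_self _) (abs_nonneg _)

/-! ### Hitting times -/

theorem exists_first_time {Z : Set ℝ} (hT : 0 ≤ T) (hZ : IsClosed (Icc 0 T ∩ Z)) :
    ∃ τ ∈ Icc 0 T, (∀ t ∈ Ico 0 τ, t ∉ Z) ∧ (τ ∈ Z ∨ τ = T) := by
  by_cases hne : (Icc 0 T ∩ Z).Nonempty
  · obtain ⟨τ, ⟨h1, h2⟩, h3⟩ :=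
      (isCompact_Icc.of_isClosed_subset hZ inter_subset_left).exists_isLeast hne
    exact ⟨τ, h1, fun t ht htZ => absurd (h3 ⟨⟨ht.1, ht.2.le.trans h1.2⟩, htZ⟩)
      (not_le.2 ht.2), Or.inl h2⟩
  · exact ⟨T, ⟨hT, le_rfl⟩, fun t ht htZ => hne ⟨t, ⟨ht.1, ht.2.le⟩, htZ⟩, Or.inr rfl⟩

/-- A function that decreases like the solutions of `d' = -β d ^ κ` reaches `0` in finite time. -/
theorem exists_hit {d d' : ℝ → ℝ} {β κ : ℝ} (hβ : 0 < β) (hκ : κ < 1) (h0 : 0 ≤ d 0)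
    (hT : T = d 0 ^ (1 - κ) / (β * (1 - κ))) (hc : ContinuousOn d (Icc 0 T))
    (hd : ∀ t ∈ Ico 0 T, HasDerivWithinAt d (d' t) (Ici t) t)
    (hle : ∀ t ∈ Ico 0 T, 0 < d t → d t ≤ d 0 → d' t ≤ -β * d t ^ κ) :
    ∃ τ ∈ Icc 0 T, d τ = 0 ∧ ∀ t ∈ Icc 0 τ, d t ∈ Icc 0 (d 0) := by
  have hκ' : 0 < 1 - κ := by linarith
  have hT0 : 0 ≤ T := by rw [hT]; positivity
  -- The decay hypothesis is available only while `d t ≤ d 0`. The level `d 0` is a barrier: `d` has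
  -- a strictly negative right derivative whenever it touches it.
  have hbd : ∀ S ≤ T, (∀ t ∈ Ico 0 S, 0 < d t) → ∀ t ∈ Icc 0 S, d t ≤ d 0 := by
    intro S hS hpos
    refine image_le_of_deriv_right_lt_deriv_boundary (f := d) (f' := d') (B := fun _ => d 0)
      (B' := fun _ => 0) (hc.mono (Icc_subset_Icc_right hS))
      (fun t ht => hd t ⟨ht.1, ht.2.trans_le hS⟩) le_rfl (fun t => hasDerivAt_const t (d 0)) ?_
    intro t ht heq
    have h1 := hpos t ht
    have h2 := hle t ⟨ht.1, ht.2.trans_le hS⟩ h1 heq.le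
    have h3 := Real.rpow_pos_of_pos h1 κ
    nlinarith
  obtain ⟨τ, hτ, hbefore, hend⟩ := exists_first_time (Z := d ⁻¹' Iic 0) hT0
    (hc.preimage_isClosed_of_isClosed isClosed_Icc isClosed_Iic)
  have hpos : ∀ t ∈ Ico 0 τ, 0 < d t := fun t ht => not_le.1 (hbefore t ht)
  have hcτ : ContinuousOn d (Icc 0 τ) := hc.mono (Icc_subset_Icc_right hτ.2)
  have hnn : ∀ t ∈ Icc 0 τ, 0 ≤ d t :=
    mem_of_mem_Ico (S := Ici 0) isClosed_Ici hcτ h0 (fun t ht => (hpos t ht).le)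
  refine ⟨τ, hτ, le_antisymm ?_ (hnn τ ⟨hτ.1, le_rfl⟩), fun t ht =>
    ⟨hnn t ht, hbd τ hτ.2 hpos t ht⟩⟩
  rcases hend with hend | rfl
  · exact hend
  -- As long as `d` is positive, `d ^ (1 - κ)` decreases at rate at least `(1 - κ) * β`, so it is
  -- used up at time `T`.
  have hw : d τ ^ (1 - κ) + (1 - κ) * β * τ ≤ d 0 ^ (1 - κ) + (1 - κ) * β * 0 := by
    refine image_le_of_deriv_right_le_deriv_boundary
      (f := fun t => d t ^ (1 - κ) + (1 - κ) * β * t)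
      (f' := fun t => d' t * (1 - κ) * d t ^ (1 - κ - 1) + (1 - κ) * β * 1)
      (a := 0) (b := τ)
      (B := fun _ => d 0 ^ (1 - κ) + (1 - κ) * β * 0) (B' := fun _ => 0)
      ?_ ?_ le_rfl continuousOn_const (fun t _ => hasDerivWithinAt_const t _ _) ?_ ⟨hT0, le_rfl⟩
    · refine ContinuousOn.add (hc.rpow_const fun t _ => Or.inr hκ'.le) (by fun_prop)
    · intro t ht
      exact ((hd t ht).rpow_const (Or.inl (hpos t ht).ne')).add
        ((hasDerivWithinAt_id t _).const_mul _)
    · intro t ht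
      have h1 := hpos t ht
      have h2 := hle t ht h1 (hbd τ le_rfl hpos t ⟨ht.1, ht.2.le⟩)
      have h3 : d t ^ κ * d t ^ (1 - κ - 1) = 1 := by
        rw [← Real.rpow_add h1]; ring_nf; exact Real.rpow_zero _
      have h4 := Real.rpow_pos_of_pos h1 (1 - κ - 1)
      have h5 := mul_le_mul_of_nonneg_right h2 (mul_nonneg hκ'.le h4.le)
      have h6 : -β * d t ^ κ * ((1 - κ) * d t ^ (1 - κ - 1)) = -β * (1 - κ) := by
        linear_combination (-β * (1 - κ)) * h3
      linarith
  have h6 : (1 - κ) * β * τ = d 0 ^ (1 - κ) := by rw [hT]; field_simp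
  have h7 : d τ ^ (1 - κ) ≤ 0 := by linarith
  by_contra hcon
  exact absurd h7 (not_le.2 (Real.rpow_pos_of_pos (not_le.1 hcon) _))

/-! ### One configuration of the network -/

/-- The properties of one configuration, in terms of the scalar velocities along the roads. -/
structure Setting (e : Fin N → State m) (b : State m → A → State m) (c : State m → A → ℝ)
    (B : Fin N → Set A) : Prop where
  ray : ∀ i j, i ≠ j → ¬ SameRay ℝ (e i) (e j)
  ne : ∀ j, e j ≠ 0
  tangent : ∀ j, ∀ a ∈ B j, ∀ r ∈ Icc (0:ℝ) 1, b (r • e j) a = speed (e j) b r a • e j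
  vertex_sub : ∀ j, localControls e b (e j) ⊆ B j
  vertex : ∀ j, ∃ a ∈ B j, speed (e j) b 1 a ≤ 0
  vertex_or : ∀ j, (∀ a ∈ B j, speed (e j) b 1 a ≤ 0) ∨ ∃ a ∈ B j, speed (e j) b 1 a < 0
  road : ∀ j, ∀ x ∈ road e j, ∃ θ : ℝ, 0 < θ ∧
    ∀ α ∈ feasibleControls e b x, ∀ᵐ t ∂(volume.restrict (Icc (0 : ℝ) θ)), α t ∈ B j
  back : ∀ j, ∃ a ∈ B j, ∃ β > 0, ∃ κ < 1, ∃ ρ > 0,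
    ∀ r, 0 < r → r ≤ ρ → speed (e j) b r a ≤ -β * r ^ (κ : ℝ)
  leave_or_wait : ∀ j, (∃ a ∈ B j, 0 < speed (e j) b 0 a) ∨
    ((∃ a ∈ B j, b 0 a = 0) ∧ (∃ ρ > 0, ∀ a ∈ B j, ∀ r, 0 < r → r ≤ ρ → speed (e j) b r a ≤ 0) ∧
      ∀ a ∈ B j, ∀ a' ∈ B j, c 0 a = c 0 a')

variable {B : Fin N → Set A}

theorem exists_const_solution (hr : IsRegular b c C K) {v : State m} (hv : v ≠ 0) (a : A) (r : ℝ) :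
    ∃ q : ℝ → ℝ, (∀ T, ContinuousOn q (Icc 0 T)) ∧
      (∀ t, 0 ≤ t → q t = r + ∫ s in (0:ℝ)..t, speed v b (q s) a) ∧
      ∀ t, 0 ≤ t → HasDerivWithinAt q (speed v b (q t) a) (Ici t) t := by
  obtain ⟨q, hqc, hq⟩ := exists_scalar_solution (hr.uniformContinuous_speed v) hr.C_pos.le
    (hr.abs_speed_le hv) (fun r s a h => hr.speed_sub_le hv h a)
    (measurable_const : Measurable fun _ : ℝ => a) r
  refine ⟨q, hqc, hq, fun t ht => ?_⟩
  have hg : Continuous fun r => speed v b r a :=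
    (hr.uniformContinuous_speed v).continuous.comp (continuous_id.prodMk continuous_const)
  have hqI : ContinuousOn q (Ici 0) := by
    intro s (hs : 0 ≤ s)
    refine (hqc (s + 1) s ⟨hs, by linarith⟩).mono_of_mem_nhdsWithin ?_
    rw [← Ici_inter_Iic]
    exact inter_mem self_mem_nhdsWithin (mem_nhdsWithin_of_mem_nhds (Iic_mem_nhds (by linarith)))
  have hc : ContinuousOn (fun s => speed v b (q s) a) (Ici 0) := hg.comp_continuousOn hqI
  have hsub : Ioi t ⊆ Ici 0 := fun s hs => ht.trans (le_of_lt hs)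
  have h1 : HasDerivWithinAt (fun u => ∫ s in (0:ℝ)..u, speed v b (q s) a)
      (speed v b (q t) a) (Ici t) t := by
    refine intervalIntegral.integral_hasDerivWithinAt_right (s := Ici t) (t := Ioi t)
      ?_ ?_ ?_
    · refine ContinuousOn.intervalIntegrable (hc.mono ?_)
      rw [uIcc_of_le ht]; exact fun s hs => hs.1
    · exact (hc.mono hsub).stronglyMeasurableAtFilter_nhdsWithin measurableSet_Ioi t
    · exact (hc t ht).mono hsub
  exact (h1.const_add r).congr (fun s hs => hq s (ht.trans hs)) (hq t ht)

/-- A constant control that moves along the road `j` with velocity bounded from below by a power of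
the distance to the target reaches this target. -/
theorem Setting.exists_arc (hs : Setting e b c B) (hr : IsRegular b c C K) {a : A} (ha : a ∈ B j)
    {r₀ r₁ σ β κ : ℝ} (h₀ : r₀ ∈ Icc (0:ℝ) 1) (h₁ : r₁ ∈ Icc (0:ℝ) 1) (hσ : σ = 1 ∨ σ = -1)
    (hβ : 0 < β) (hκ : κ < 1) (hd : 0 ≤ σ * (r₀ - r₁))
    (hspeed : ∀ r, 0 < σ * (r - r₁) → σ * (r - r₁) ≤ σ * (r₀ - r₁) →
      σ * speed (e j) b r a ≤ -β * (σ * (r - r₁)) ^ κ) :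
    ∃ τ, 0 ≤ τ ∧ τ ≤ (σ * (r₀ - r₁)) ^ (1 - κ) / (β * (1 - κ)) ∧
      ∃ α y, IsArc e b (r₀ • e j) τ α y ∧ y τ = r₁ • e j := by
  obtain ⟨q, hqc, hq, hqd⟩ := exists_const_solution hr (hs.ne j) a r₀
  have hq0 : q 0 = r₀ := by simpa using hq 0 le_rfl
  -- The remaining distance is `σ * (q - r₁)`, with `σ = 1` for motion towards the intersection and
  -- `σ = -1` for motion away from it.
  obtain ⟨τ, hτ, hτ0, hin⟩ := exists_hit (d := fun t => σ * (q t - r₁))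
    (d' := fun t => σ * speed (e j) b (q t) a) hβ hκ (by simpa [hq0] using hd) rfl
    (continuousOn_const.mul ((hqc _).sub continuousOn_const))
    (fun t ht => ((hqd t ht.1).sub_const r₁).const_mul σ)
    (fun t _ h1 h2 => hspeed _ h1 (by simpa [hq0] using h2))
  simp only [hq0] at hin hτ
  refine ⟨τ, hτ.1, hτ.2, fun _ => a, fun t => q t • e j, ?_, ?_⟩
  · refine isArc_of_scalar (hs.tangent j) measurable_const
      (Eventually.of_forall fun _ _ => ha) (hqc τ) (fun t ht => hq t ht.1) fun t ht => ?_
    have := hin t ht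
    rcases hσ with rfl | rfl <;> constructor <;> linarith [this.1, this.2, h₀.1, h₀.2, h₁.1, h₁.2]
  · have : q τ = r₁ := by
      rcases hσ with rfl | rfl <;> linarith
    simp only [this]

/-! ### Existence of feasible controls -/

/-- The period index `⌈t / T⌉₊ - 1` is constant on `(kT, (k+1)T]`, matching `glue`, which uses its
first curve up to and including `T`. Truncated subtraction puts `t ≤ 0` into the first period. -/
theorem glue_periodic {X : Type*} (hT : 0 < T) (f : ℝ → X) :
    glue T f (fun t => f (t - T * ((⌈t / T⌉₊ - 1 : ℕ) : ℝ)))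
      = fun t => f (t - T * ((⌈t / T⌉₊ - 1 : ℕ) : ℝ)) := by
  ext t
  rcases le_or_gt t T with ht | ht
  · rw [glue_of_le ht]
    have : ⌈t / T⌉₊ ≤ 1 := Nat.ceil_le.2 (by rw [Nat.cast_one]; exact (div_le_one hT).2 ht)
    rw [Nat.sub_eq_zero_of_le this]
    simp
  · rw [glue_of_lt ht]
    have h1 : t / T = (t - T) / T + 1 := by field_simp; ring
    have h2 : ⌈t / T⌉₊ = ⌈(t - T) / T⌉₊ + 1 := by
      rw [h1]; exact_mod_cast Nat.ceil_add_one (by rw [le_div_iff₀ hT]; linarith)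
    have h3 : 1 ≤ ⌈(t - T) / T⌉₊ := Nat.one_le_iff_ne_zero.2 (by
      rw [Ne, Nat.ceil_eq_zero, not_le]
      exact div_pos (by linarith) hT)
    rw [h2, Nat.add_sub_cancel, Nat.cast_sub h3]
    congr 1
    push_cast
    ring

theorem IsArc.exists_feasible_of_loop (hr : IsRegular b c C K) (h : IsArc e b x T α y)
    (hT : 0 < T) (hloop : y T = x) : ∃ α y, IsFeasible e b x α y := by
  set α' : ℝ → A := fun t => α (t - T * ((⌈t / T⌉₊ - 1 : ℕ) : ℝ)) with hα'
  set y' : ℝ → State m := fun t => y (t - T * ((⌈t / T⌉₊ - 1 : ℕ) : ℝ)) with hy'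
  have hmeas : Measurable α' := by
    refine h.meas.comp (measurable_id.sub (measurable_const.mul ?_))
    exact (measurable_from_nat (f := fun n : ℕ => ((n - 1 : ℕ) : ℝ))).comp
      (Nat.measurable_ceil.comp (measurable_id.div_const T))
  have h0 : y' 0 = x := by simp [hy', h.zero hT.le]
  have hn : ∀ n : ℕ, IsArc e b x (n * T) α' y' := by
    intro n
    induction n with
    | zero =>
      have hm := h.mem 0 ⟨le_rfl, hT.le⟩
      rw [h.zero hT.le] at hm
      refine ⟨hmeas, ?_, ?_, ?_⟩ <;> simp [h0, hm]
    | succ n ih =>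
      -- The extra loop is put in front: the periodic extension is unchanged by this.
      have h2 := h.append hr (hloop ▸ ih) hT.le (by positivity)
      have e1 : glue T α α' = α' := glue_periodic hT α
      have e2 : glue T y y' = y' := glue_periodic hT y
      rw [e1, e2] at h2
      convert h2 using 1
      push_cast
      ring
  refine ⟨α', y', fun S hS => (hn ⌈S / T⌉₊).mono ?_⟩
  exact (div_le_iff₀ hT).1 (Nat.le_ceil _)

/-- From every point of a road one can stay in the network forever or go to the intersection. -/
theorem Setting.feasible_or_arc (hs : Setting e b c B) (hr : IsRegular b c C K) {r : ℝ}
    (hr01 : r ∈ Icc (0:ℝ) 1) : (∃ α y, IsFeasible e b (r • e j) α y) ∨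
      ∃ τ, 0 ≤ τ ∧ ∃ α y, IsArc e b (r • e j) τ α y ∧ y τ = 0 := by
  -- This control cannot push the coordinate beyond `1`, so the road can only be left through the
  -- intersection.
  obtain ⟨a, ha, ha1⟩ := hs.vertex j
  obtain ⟨q, hqc, hq, -⟩ := exists_const_solution hr (hs.ne j) a r
  have hq0 : q 0 = r := by simpa using hq 0 le_rfl
  have hle : ∀ t, 0 ≤ t → q t ≤ 1 := by
    intro t ht
    exact hr.le_of_speed_nonpos (hs.ne j) (measurable_const : Measurable fun _ : ℝ => a) ht
      (hqc t) (fun s hs => hq s hs.1) hr01.2 (Eventually.of_forall fun _ _ => ha1) t ⟨ht, le_rfl⟩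
  have harc : ∀ τ, (∀ t ∈ Icc 0 τ, 0 ≤ q t) →
      IsArc e b (r • e j) τ (fun _ => a) (fun t => q t • e j) := fun τ hpos =>
    isArc_of_scalar (hs.tangent j) measurable_const (Eventually.of_forall fun _ _ => ha) (hqc τ)
      (fun t ht => hq t ht.1) fun t ht => ⟨hpos t ht, hle t ht.1⟩
  by_cases hex : ∃ t, 0 ≤ t ∧ q t ≤ 0
  · obtain ⟨S, hS, hqS⟩ := hex
    obtain ⟨τ, hτ, hbefore, hend⟩ := exists_first_time (Z := q ⁻¹' Iic 0) hS
      ((hqc S).preimage_isClosed_of_isClosed isClosed_Icc isClosed_Iic)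
    have hnn : ∀ t ∈ Icc 0 τ, 0 ≤ q t := mem_of_mem_Ico (S := Ici 0) isClosed_Ici (hqc τ)
      (by rw [hq0]; exact hr01.1) (fun t ht => show (0:ℝ) ≤ q t from (not_le.1 (hbefore t ht)).le)
    have hτ0 : q τ ≤ 0 := by
      rcases hend with h | rfl
      · exact h
      · exact hqS
    refine Or.inr ⟨τ, hτ.1, _, _, harc τ hnn, ?_⟩
    simp only [le_antisymm hτ0 (hnn τ ⟨hτ.1, le_rfl⟩), zero_smul]
  · push Not at hex
    exact Or.inl ⟨_, _, fun τ _ => harc τ fun t ht => (hex t ht.1).le⟩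

theorem IsRegular.exists_speed_near (hr : IsRegular b c C K) (v : State m) (a : A) {r s σ : ℝ}
    (h : s < σ * speed v b r a) : ∃ ρ > 0, ∀ p, |p - r| ≤ ρ → s < σ * speed v b p a := by
  have hg : Continuous fun r => σ * speed v b r a :=
    continuous_const.mul
      ((hr.uniformContinuous_speed v).continuous.comp (continuous_id.prodMk continuous_const))
  have := hg.continuousAt.eventually (lt_mem_nhds h)
  obtain ⟨ρ, hρ, hball⟩ := Metric.nhds_basis_closedBall.eventually_iff.1 this
  exact ⟨ρ, hρ, fun p hp => hball (by rwa [Metric.mem_closedBall, Real.dist_eq])⟩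

/-- On a road that can be entered, small positions are reached quickly from the intersection. -/
theorem Setting.exists_arc_leave (hs : Setting e b c B) (hr : IsRegular b c C K) {a : A}
    (ha : a ∈ B j) (hpos : 0 < speed (e j) b 0 a) : ∃ β > 0, ∃ ρ > 0, ∀ r ∈ Icc (0:ℝ) 1, r ≤ ρ →
      ∃ τ, 0 ≤ τ ∧ τ ≤ r / β ∧ ∃ α y, IsArc e b 0 τ α y ∧ y τ = r • e j := by
  obtain ⟨ρ, hρ, hnear⟩ := hr.exists_speed_near (e j) a (r := 0) (s := speed (e j) b 0 a / 2)
    (σ := 1) (by linarith)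
  refine ⟨speed (e j) b 0 a / 2, by linarith, ρ, hρ, fun r hr01 hrρ => ?_⟩
  have := hs.exists_arc hr ha (r₀ := 0) (r₁ := r) (σ := -1) (β := speed (e j) b 0 a / 2) (κ := 0)
    ⟨le_rfl, zero_le_one⟩ hr01 (Or.inr rfl) (by linarith) one_pos (by linarith [hr01.1]) ?_
  · simpa using this
  · intro p h1 h2
    have := hnear p (by rw [abs_le]; constructor <;> linarith)
    rw [Real.rpow_zero]
    linarith

/-- If road `j` can be entered, one moves out and then either stays on the network forever or comes
back, which closes a loop of positive duration. Otherwise a control with zero velocity allows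
waiting. -/
theorem Setting.exists_feasible_zero (hs : Setting e b c B) (hr : IsRegular b c C K) (j : Fin N) :
    ∃ α y, IsFeasible e b 0 α y := by
  have hmem : (0 : State m) ∈ network e :=
    closedRoad_subset (j := j) ⟨0, ⟨le_rfl, zero_le_one⟩, zero_smul _ _⟩
  rcases hs.leave_or_wait j with ⟨a, ha, hpos⟩ | ⟨⟨a, ha, hz⟩, -, -⟩
  · obtain ⟨β, hβ, ρ, hρ, harc⟩ := hs.exists_arc_leave hr ha hpos
    have hr1 : min 1 ρ ∈ Icc (0:ℝ) 1 := ⟨le_min zero_le_one hρ.le, min_le_left _ _⟩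
    obtain ⟨τ, hτ, -, α, y, h1, h2⟩ := harc (min 1 ρ) hr1 (min_le_right _ _)
    have hτ0 : 0 < τ := by
      refine lt_of_le_of_ne hτ fun h0 => ?_
      rw [← h0, h1.zero hτ] at h2
      exact smul_ne_zero (lt_min one_pos hρ).ne' (hs.ne j) h2.symm
    rcases hs.feasible_or_arc hr (j := j) hr1 with ⟨α', y', h'⟩ | ⟨τ', hτ', α', y', h', hend⟩
    · exact ⟨_, _, h1.append_feasible hr (h2 ▸ h') hτ⟩
    · refine (h1.append hr (h2 ▸ h') hτ hτ').exists_feasible_of_loop hr (by linarith) ?_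
      rcases hτ'.eq_or_lt with h0 | h0
      · have h3 : y' 0 = min 1 ρ • e j := h'.zero hτ'
        rw [← h0] at hend
        rw [← h0, add_zero, glue_of_le le_rfl, h2, ← h3, hend]
      · rw [glue_of_lt (by linarith), add_sub_cancel_left, hend]
  · exact ⟨fun _ => a, fun _ => 0, fun T _ => ⟨measurable_const, continuousOn_const,
      fun t _ => by simp [hz], fun t _ => hmem⟩⟩

theorem Setting.exists_feasible (hs : Setting e b c B) (hr : IsRegular b c C K) :
    ∀ x ∈ network e, ∃ α y, IsFeasible e b x α y := by
  intro x hx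
  obtain ⟨j, r, hr01, rfl⟩ := mem_iUnion.1 hx
  rcases hs.feasible_or_arc hr (j := j) hr01 with h | ⟨τ, hτ, α, y, h, hend⟩
  · exact h
  · obtain ⟨α', y', h'⟩ := hs.exists_feasible_zero hr j
    exact ⟨_, _, h.append_feasible hr (hend ▸ h') hτ⟩

end

/-! ## Continuity of the value function -/

section

variable {m N : ℕ} {A : Type*} [MetricSpace A] [CompactSpace A] [MeasurableSpace A] [BorelSpace A]

variable {e : Fin N → State m} {b : State m → A → State m} {c : State m → A → ℝ}
  {C K δ : ℝ} {x z : State m} {T : ℝ} {α : ℝ → A} {y : ℝ → State m} {j : Fin N}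
  {B : Fin N → Set A}

/-! ### Continuity at the intersection and at the vertices -/

theorem exists_pos_rpow_le {β κ M ε : ℝ} (hκ : κ < 1) (hε : 0 < ε) :
    ∃ η > 0, ∀ s, 0 ≤ s → s ≤ η → M * (s ^ (1 - κ) / (β * (1 - κ))) ≤ ε := by
  have hc : ContinuousAt (fun s : ℝ => M * (s ^ (1 - κ) / (β * (1 - κ)))) 0 :=
    continuousAt_const.mul
      ((Real.continuousAt_rpow_const 0 (1 - κ) (Or.inr (by linarith))).div_const _)
  have h0 : M * ((0:ℝ) ^ (1 - κ) / (β * (1 - κ))) < ε := by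
    rw [Real.zero_rpow (by linarith)]; simpa using hε
  obtain ⟨η, hη, hball⟩ := Metric.nhds_basis_closedBall.eventually_iff.1
    (hc.eventually (gt_mem_nhds h0))
  refine ⟨η, hη, fun s hs hsη => (hball ?_).le⟩
  rw [Metric.mem_closedBall, Real.dist_eq, sub_zero, abs_of_nonneg hs]
  exact hsη

/-- Two values differ by at most `2 * (K / δ)`, so after this horizon their discounted difference is
negligible. -/
theorem exists_horizon (hδ : 0 < δ) {ε : ℝ} (hε : 0 < ε) :
    ∃ T, 0 ≤ T ∧ Real.exp (-δ * T) * (2 * (K / δ)) ≤ ε := by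
  have h1 : Tendsto (fun T : ℝ => Real.exp (-δ * T) * (2 * (K / δ))) atTop (𝓝 0) := by
    have : Tendsto (fun T : ℝ => Real.exp (-δ * T)) atTop (𝓝 0) :=
      Real.tendsto_exp_atBot.comp (tendsto_id.const_mul_atTop_of_neg (neg_lt_zero.2 hδ))
    simpa using this.mul_const (2 * (K / δ))
  obtain ⟨T, hT, hT0⟩ := ((h1.eventually (gt_mem_nhds hε)).and (eventually_ge_atTop 0)).exists
  exact ⟨T, hT0, hT.le⟩

theorem Setting.value_sub_le (hs : Setting e b c B) (hr : IsRegular b c C K) (hδ : 0 < δ)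
    (hx : x ∈ network e) (hz : z ∈ network e) :
    value e b c δ x - value e b c δ z ≤ 2 * (K / δ) := by
  have h1 := abs_le.1 (abs_value_le hr hδ (hs.exists_feasible hr x hx))
  have h2 := abs_le.1 (abs_value_le hr hδ (hs.exists_feasible hr z hz))
  linarith [h1.2, h2.1]

theorem mem_network_smul {r : ℝ} (hr : r ∈ Icc (0:ℝ) 1) : r • e j ∈ network e :=
  closedRoad_subset (j := j) ⟨r, hr, rfl⟩

/-- The control of `Setting.back` reaches the intersection in a time that tends to zero with `r`,
because `κ < 1`; `IsArc.value_le_add` converts this time into a cost. -/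
theorem Setting.value_le_value_zero (hs : Setting e b c B) (hr : IsRegular b c C K) (hδ : 0 < δ)
    (j : Fin N) {ε : ℝ} (hε : 0 < ε) : ∃ η > 0, ∀ r ∈ Icc (0:ℝ) 1, r ≤ η →
      value e b c δ (r • e j) ≤ value e b c δ 0 + ε := by
  obtain ⟨a, ha, β, hβ, κ, hκ, ρ, hρ, hback⟩ := hs.back j
  obtain ⟨η, hη, hηle⟩ := exists_pos_rpow_le (β := β) (M := 2 * K) hκ hε
  refine ⟨min η ρ, lt_min hη hρ, fun r hr01 hrη => ?_⟩
  obtain ⟨τ, hτ, hτle, α, y, hy, hend⟩ := hs.exists_arc hr ha (r₀ := r) (r₁ := 0) (σ := 1) hr01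
    ⟨le_rfl, zero_le_one⟩ (Or.inl rfl) hβ hκ (by linarith [hr01.1]) (fun p h1 h2 => by
      have := hback p (by linarith) (by linarith [hrη.trans (min_le_right η ρ)])
      simpa using this)
  have h1 := hy.value_le_add hr hδ (hs.exists_feasible hr) hτ
  rw [hend, zero_smul] at h1
  have h2 := hηle r hr01.1 (hrη.trans (min_le_left _ _))
  rw [one_mul, sub_zero] at hτle
  have h3 := mul_le_mul_of_nonneg_left hτle (by linarith [hr.K_pos] : 0 ≤ 2 * K)
  linarith

theorem Setting.value_vertex_le (hs : Setting e b c B) (hr : IsRegular b c C K) (hδ : 0 < δ)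
    {a : A} (ha : a ∈ B j) (hneg : speed (e j) b 1 a < 0) {ε : ℝ} (hε : 0 < ε) :
    ∃ η > 0, ∀ r ∈ Icc (0:ℝ) 1, 1 - r ≤ η →
      value e b c δ (e j) ≤ value e b c δ (r • e j) + ε := by
  obtain ⟨ρ, hρ, hnear⟩ := hr.exists_speed_near (e j) a (r := 1) (s := -speed (e j) b 1 a / 2)
    (σ := -1) (by linarith)
  have hβ : 0 < -speed (e j) b 1 a / 2 := by linarith
  obtain ⟨η, hη, hηle⟩ := exists_pos_rpow_le (β := -speed (e j) b 1 a / 2) (M := 2 * K) one_pos hε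
  refine ⟨min η ρ, lt_min hη hρ, fun r hr01 hrη => ?_⟩
  obtain ⟨τ, hτ, hτle, α, y, hy, hend⟩ := hs.exists_arc hr ha (r₀ := 1) (r₁ := r) (σ := 1) (κ := 0)
    ⟨zero_le_one, le_rfl⟩ hr01 (Or.inl rfl) hβ one_pos (by linarith [hr01.2]) (fun p h1 h2 => by
      have := hnear p (by
        rw [abs_le]
        constructor <;> linarith [hrη.trans (min_le_right η ρ)])
      rw [Real.rpow_zero]
      linarith)
  have h1 := hy.value_le_add hr hδ (hs.exists_feasible hr) hτ
  rw [hend, one_smul] at h1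
  have h2 := hηle (1 - r) (by linarith [hr01.2]) (hrη.trans (min_le_left _ _))
  rw [one_mul] at hτle
  have h3 := mul_le_mul_of_nonneg_left hτle (by linarith [hr.K_pos] : 0 ≤ 2 * K)
  linarith

/-- A feasible pair on a road, up to the first time at which it meets the intersection or at which
a second, scalar, continuous function enters a given closed set. -/
theorem Setting.exists_stop (hs : Setting e b c B) (hr : IsRegular b c C K)
    (hx : x ∈ closedRoad e j) (h : IsFeasible e b x α y) (hT : 0 ≤ T) {q : ℝ → ℝ}
    (hq : ContinuousOn q (Icc 0 T)) {Z : Set ℝ} (hZ : IsClosed Z) :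
    ∃ τ ∈ Icc 0 T, (∀ t ∈ Ico 0 τ, q t ∉ Z) ∧ (y τ = 0 ∨ q τ ∈ Z ∨ τ = T) ∧
      (∀ t ∈ Icc 0 τ, y t ∈ closedRoad e j) ∧ ∀ᵐ t, t ∈ Icc 0 τ → α t ∈ B j := by
  have hA := h T hT
  have hcl : IsClosed (Icc 0 T ∩ (y ⁻¹' {0} ∪ q ⁻¹' Z)) := by
    rw [inter_union_distrib_left]
    exact (hA.cont.preimage_isClosed_of_isClosed isClosed_Icc isClosed_singleton).union
      (hq.preimage_isClosed_of_isClosed isClosed_Icc hZ)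
  obtain ⟨τ, hτ, hbefore, hend⟩ := exists_first_time hT hcl
  have hne : ∀ t ∈ Ico 0 τ, y t ≠ 0 := fun t ht h0 => hbefore t ht (Or.inl h0)
  have hroad := (hA.mono hτ.2).mem_closedRoad hs.ray hx hne
  refine ⟨τ, hτ, fun t ht hqt => hbefore t ht (Or.inr hqt), ?_, hroad,
    h.ae_mem hr (hs.vertex_sub j) (hs.road j) hτ.1 hroad hne⟩
  rcases hend with (h1 | h1) | h1
  exacts [Or.inl h1, Or.inr (Or.inl h1), Or.inr (Or.inr h1)]

theorem Setting.value_zero_le (hs : Setting e b c B) (hr : IsRegular b c C K) (hδ : 0 < δ)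
    (j : Fin N) {ε : ℝ} (hε : 0 < ε) : ∃ η > 0, ∀ r ∈ Icc (0:ℝ) 1, r ≤ η →
      value e b c δ 0 ≤ value e b c δ (r • e j) + ε := by
  have hK := hr.K_pos
  have hv := hs.ne j
  have hv' : 0 < ‖e j‖ := norm_pos_iff.2 hv
  rcases hs.leave_or_wait j with ⟨a, ha, hpos⟩ | ⟨⟨a₀, ha₀, hz⟩, ⟨ρ, hρ, hnon⟩, hconst⟩
  · obtain ⟨β, hβ, ρ, hρ, harc⟩ := hs.exists_arc_leave hr ha hpos
    refine ⟨min ρ (ε * β / (2 * K)), by positivity, fun r hr01 hrη => ?_⟩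
    obtain ⟨τ, hτ, hτle, α, y, hy, hend⟩ := harc r hr01 (hrη.trans (min_le_left _ _))
    have h1 := hy.value_le_add hr hδ (hs.exists_feasible hr) hτ
    rw [hend] at h1
    have h2 : r / β ≤ ε / (2 * K) := by
      have := hrη.trans (min_le_right _ _)
      rw [div_le_iff₀ hβ]
      calc r ≤ _ := this
        _ = _ := by ring
    have h3 : 2 * K * τ ≤ ε := by
      have := (le_div_iff₀ (by positivity)).1 (hτle.trans h2)
      linarith
    linarith
  -- On a road that may be impossible to enter, waiting at the intersection competes with a nearly
  -- optimal pair from `r • e j`. No control passes the level `r` outwards, so that pair stays in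
  -- `[0, r]` until it meets the intersection or the horizon is reached.
  · obtain ⟨T, hT, hhor⟩ := exists_horizon (δ := δ) hδ (K := K) (ε := ε / 3) (by positivity)
    refine ⟨min ρ (ε / 3 * δ / (K * ‖e j‖)), by positivity, fun r hr01 hrη => ?_⟩
    rcases hr01.1.eq_or_lt with h0 | h0
    · rw [← h0, zero_smul]; linarith
    have hxn : r • e j ∈ network e := mem_network_smul hr01
    obtain ⟨α, y, h, hlt⟩ := exists_cost_lt (δ := δ) hr (hs.exists_feasible hr _ hxn)
      (lt_add_of_pos_right (value e b c δ (r • e j)) (by positivity : 0 < ε / 3))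
    obtain ⟨τ, hτ, -, hend, hroad, hB⟩ := hs.exists_stop hr (j := j) ⟨r, hr01, rfl⟩ h hT
      (q := fun _ => 0) continuousOn_const isClosed_empty
    have hA := (h T hT).mono hτ.2
    have hle : ∀ t ∈ Icc 0 τ, coord (e j) (y t) ≤ r := by
      have hc := hA.coord_eq hr hv hτ.1 hroad
      refine hr.le_of_speed_nonpos hv hA.meas hτ.1
        ((coord (e j)).continuous.comp_continuousOn hA.cont) hc (by rw [coord_smul hv]) ?_
      filter_upwards [hB] with s hs' hsT
      exact hnon _ (hs' hsT) r h0 (hrη.trans (min_le_left _ _))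
    have harc : IsArc e b 0 τ (fun _ => a₀) (fun _ => 0) :=
      ⟨measurable_const, continuousOn_const, fun t _ => by simp [hz], fun t _ => by
        have := mem_network_smul (e := e) (j := j) (r := 0) ⟨le_rfl, zero_le_one⟩
        rwa [zero_smul] at this⟩
    have hmain := harc.value_le_of_close hr hδ (hs.exists_feasible hr) h hτ.1
      (κ := K * (r * ‖e j‖)) (ε := ε / 3) (by have := hr01.1; positivity) ?_ ?_
    · have h1 : K * (r * ‖e j‖) / δ ≤ ε / 3 := by
        have := (le_div_iff₀ (by positivity)).1 (hrη.trans (min_le_right _ _))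
        rw [div_le_iff₀ hδ]
        linarith
      linarith
    · filter_upwards [hB] with t htB ht
      -- The cost at the intersection is independent of the control, so `a₀` may be replaced by `α
      -- t`; only the Lipschitz dependence on the position remains.
      rw [hconst a₀ ha₀ (α t) (htB ht)]
      refine (le_abs_self _).trans ((hr.cost_lip _ _ _).trans ?_)
      gcongr
      have h1 := coord_mem hv (hroad t ht)
      rw [zero_sub, norm_neg, ← h1.2, norm_smul, Real.norm_of_nonneg h1.1.1]
      gcongr
      exact hle t ht
    · rcases hend with h1 | h1 | h1
      · rw [h1, sub_self, mul_zero]; positivity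
      · exact absurd h1 (notMem_empty _)
      · subst h1
        refine le_trans ?_ hhor
        gcongr
        exact hs.value_sub_le hr hδ (harc.mem τ ⟨hT, le_rfl⟩) (hA.mem τ ⟨hT, le_rfl⟩)

/-! ### Continuity along a road -/

theorem Setting.value_le_value (hs : Setting e b c B) (hr : IsRegular b c C K) (hδ : 0 < δ)
    (j : Fin N) {ε : ℝ} (hε : 0 < ε) : ∃ η > 0, ∀ r ∈ Icc (0:ℝ) 1, ∀ s ∈ Icc (0:ℝ) 1, |s - r| ≤ η →
      value e b c δ (s • e j) ≤ value e b c δ (r • e j) + ε := by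
  have hK := hr.K_pos
  have hv := hs.ne j
  have hv' : 0 < ‖e j‖ := norm_pos_iff.2 hv
  have hε4 : 0 < ε / 4 := by positivity
  obtain ⟨η₁, hη₁, hO₁⟩ := hs.value_le_value_zero hr hδ j hε4
  obtain ⟨η₂, hη₂, hO₂⟩ := hs.value_zero_le hr hδ j hε4
  -- `Z` contains the positions of the second trajectory at which the comparison stops
  obtain ⟨η₃, hη₃, Z, hZcl, hZ0, hZ1, hZ⟩ : ∃ η₃ > 0, ∃ Z : Set ℝ, IsClosed Z ∧
      (∀ r ≤ 0, r ∈ Z) ∧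
      ((∀ a ∈ B j, speed (e j) b 1 a ≤ 0) ∨ ∀ r, 1 ≤ r → r ∈ Z) ∧
      ∀ p ∈ Z, 0 < p → p ≤ 1 → p = 1 ∧ ∀ r ∈ Icc (0:ℝ) 1, 1 - r ≤ η₃ →
        value e b c δ (e j) ≤ value e b c δ (r • e j) + ε / 4 := by
    -- If no control pushes outwards at the vertex, the second solution cannot pass `1` and need not
    -- be stopped there. Otherwise it is stopped at `1`, where a strictly inward control exists.
    -- Half-lines are used because the scalar solution lives on the whole line.
    rcases hs.vertex_or j with hall | ⟨a, ha, hneg⟩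
    · exact ⟨1, one_pos, Iic 0, isClosed_Iic, fun r hr => hr, Or.inl hall,
        fun p hp hp0 => absurd hp (not_le.2 hp0)⟩
    · obtain ⟨η₃, hη₃, hV⟩ := hs.value_vertex_le hr hδ ha hneg hε4
      refine ⟨η₃, hη₃, Iic 0 ∪ Ici 1, isClosed_Iic.union isClosed_Ici, fun r hr => Or.inl hr,
        Or.inr fun r hr => Or.inr hr, fun p hp hp0 hp1 => ⟨?_, hV⟩⟩
      rcases hp with hp | hp
      · exact absurd hp (not_le.2 hp0)
      · exact le_antisymm hp1 hp
  obtain ⟨T, hT, hhor⟩ := exists_horizon (δ := δ) hδ (K := K) hε4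
  set E := Real.exp (C * T) with hE
  have hE0 : 0 < E := Real.exp_pos _
  -- The first three bounds serve the local estimates at the stopping time, the last one the running
  -- cost. Dividing by `E` compensates the Grönwall growth up to the horizon.
  set η := min (min η₁ η₂) (min η₃ (ε / 4 * δ / (K * ‖e j‖))) with hη
  have hη0 : 0 < η := by positivity
  refine ⟨η / E, by positivity, fun r hr01 s hs01 hrs => ?_⟩
  have hrsE : |s - r| * E ≤ η := (le_div_iff₀ hE0).1 hrs
  obtain ⟨α, y, h, hlt⟩ := exists_cost_lt (δ := δ) hr
    (hs.exists_feasible hr _ (mem_network_smul hr01))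
    (lt_add_of_pos_right (value e b c δ (r • e j)) hε4)
  have hα := (h T hT).meas
  obtain ⟨q, hqc, hq⟩ := exists_scalar_solution (hr.uniformContinuous_speed (e j)) hr.C_pos.le
    (hr.abs_speed_le hv) (fun r s a h => hr.speed_sub_le hv h a) hα s
  have hq0 : q 0 = s := by simpa using hq 0 le_rfl
  obtain ⟨τ, hτ, hbefore, hend, hroad, hB⟩ := hs.exists_stop hr (j := j) ⟨r, hr01, rfl⟩ h hT
    (hqc T) hZcl
  have hA := (h T hT).mono hτ.2
  set p : ℝ → ℝ := fun t => coord (e j) (y t) with hp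
  have hpeq : ∀ t ∈ Icc 0 τ, p t = r + ∫ s in (0:ℝ)..t, speed (e j) b (p s) (α s) := by
    have := hA.coord_eq hr hv hτ.1 hroad
    rwa [coord_smul hv] at this
  have hpc : ContinuousOn p (Icc 0 τ) := (coord (e j)).continuous.comp_continuousOn hA.cont
  have hp01 : ∀ t ∈ Icc 0 τ, p t ∈ Icc (0:ℝ) 1 ∧ p t • e j = y t := fun t ht =>
    coord_mem hv (hroad t ht)
  have hqeq : ∀ t ∈ Icc 0 τ, q t = s + ∫ s in (0:ℝ)..t, speed (e j) b (q s) (α s) :=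
    fun t ht => hq t ht.1
  have hexp : ∀ t ∈ Icc 0 τ, |s - r| * Real.exp (C * t) ≤ η := fun t ht => by
    refine le_trans ?_ hrsE
    exact mul_le_mul_of_nonneg_left (Real.exp_le_exp.2
      (mul_le_mul_of_nonneg_left (ht.2.trans hτ.2) hr.C_pos.le)) (abs_nonneg _)
  have hclose : ∀ t ∈ Icc 0 τ, |q t - p t| ≤ η := by
    intro t ht
    have h1 := hr.sub_le_of_speed hv hα hτ.1 (hqc τ) hpc hqeq hpeq t ht
    have h2 := hr.sub_le_of_speed hv hα hτ.1 hpc (hqc τ) hpeq hqeq t ht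
    rw [abs_sub_comm r s] at h2
    have h3 := hexp t ht
    rw [abs_le]
    constructor <;> linarith
  have hq01 : ∀ t ∈ Icc 0 τ, q t ∈ Icc (0:ℝ) 1 := by
    intro t ht
    have hge : 0 ≤ q t := mem_of_mem_Ico (S := Ici 0) isClosed_Ici (hqc τ)
      (by rw [hq0]; exact hs01.1) (fun t ht => show (0:ℝ) ≤ q t from
        (not_le.1 fun hcon => hbefore t ht (hZ0 _ hcon)).le) t ht
    refine ⟨hge, ?_⟩
    rcases hZ1 with hall | hZ1
    · refine hr.le_of_speed_nonpos hv hα hτ.1 (hqc τ) hqeq hs01.2 ?_ t ht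
      filter_upwards [hB] with t htB ht
      exact hall _ (htB ht)
    · exact mem_of_mem_Ico (S := Iic 1) isClosed_Iic (hqc τ)
        (by rw [hq0]; exact hs01.2) (fun t ht => show q t ≤ 1 from
          (not_le.1 fun hcon => hbefore t ht (hZ1 _ hcon)).le) t ht
  have harc := isArc_of_scalar (hs.tangent j) hα hB (hqc τ) hqeq hq01
  have hmain := harc.value_le_of_close hr hδ (hs.exists_feasible hr) h hτ.1
    (κ := K * (η * ‖e j‖)) (ε := ε / 4) (by positivity) ?_ ?_
  · have h1 : K * (η * ‖e j‖) / δ ≤ ε / 4 := by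
      have := (le_div_iff₀ (by positivity)).1
        ((min_le_right (min η₁ η₂) _).trans (min_le_right η₃ (ε / 4 * δ / (K * ‖e j‖))))
      rw [div_le_iff₀ hδ]
      linarith
    linarith
  · refine Eventually.of_forall fun t ht => ?_
    refine (le_abs_self _).trans ((hr.cost_lip _ _ _).trans ?_)
    gcongr
    rw [← (hp01 t ht).2, ← sub_smul, norm_smul]
    gcongr
    exact hclose t ht
  · have hττ : τ ∈ Icc 0 τ := ⟨hτ.1, le_rfl⟩
    have hcl := abs_le.1 (hclose τ hττ)
    have hexp0 := Real.exp_pos (-δ * τ)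
    have hexp1 : Real.exp (-δ * τ) ≤ 1 := Real.exp_le_one_iff.2 (by nlinarith [hτ.1])
    have hred : value e b c δ (q τ • e j) - value e b c δ (y τ) ≤ ε / 4 →
        Real.exp (-δ * τ) * (value e b c δ (q τ • e j) - value e b c δ (y τ)) ≤ ε / 4 := by
      intro hle
      nlinarith
    have hη1 : η ≤ η₁ := (min_le_left _ _).trans (min_le_left _ _)
    have hη2 : η ≤ η₂ := (min_le_left _ _).trans (min_le_right _ _)
    have hη3 : η ≤ η₃ := (min_le_right _ _).trans (min_le_left _ _)
    -- The first trajectory is at the intersection; or the second one is at the intersection or at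
    -- the vertex; or the horizon is reached. In each of the first two cases the other trajectory is
    -- within `η`.
    rcases hend with h0 | h0 | h0
    · apply hred
      have hp0 : p τ = 0 := by simp only [hp, h0, map_zero]
      have := hO₁ (q τ) (hq01 τ hττ) (by linarith [hcl.2])
      rw [h0]
      linarith
    · apply hred
      rcases (hq01 τ hττ).1.eq_or_lt with hq' | hq'
      · have := hO₂ (p τ) (hp01 τ hττ).1 (by linarith [hcl.1])
        rw [(hp01 τ hττ).2] at this
        rw [← hq', zero_smul]
        linarith
      · obtain ⟨h1, h2⟩ := hZ _ h0 hq' (hq01 τ hττ).2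
        have := h2 (p τ) (hp01 τ hττ).1 (by linarith [hcl.2])
        rw [(hp01 τ hττ).2] at this
        rw [h1, one_smul]
        linarith
    · subst h0
      refine le_trans ?_ hhor
      gcongr
      exact hs.value_sub_le hr hδ (harc.mem τ hττ) (hA.mem τ hττ)

theorem Setting.continuousOn_value (hs : Setting e b c B) (hr : IsRegular b c C K) (hδ : 0 < δ) :
    ContinuousOn (fun x => value e b c δ x) (network e) := by
  -- Continuity on each member of a finite closed cover suffices, so points on different roads are
  -- never compared directly.
  refine (locallyFinite_of_finite (closedRoad e)).continuousOn_iUnion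
    (fun j => isCompact_closedRoad.isClosed) fun j => ?_
  have hv := hs.ne j
  have hv' : 0 < ‖e j‖ := norm_pos_iff.2 hv
  rw [Metric.continuousOn_iff]
  rintro x ⟨r, hr01, rfl⟩ ε hε
  obtain ⟨η, hη, hval⟩ := hs.value_le_value hr hδ j (half_pos hε)
  refine ⟨η * ‖e j‖, by positivity, ?_⟩
  rintro z ⟨s, hs01, rfl⟩ hdist
  simp only [dist_eq_norm, ← sub_smul, norm_smul, Real.norm_eq_abs] at hdist ⊢
  have hsr : |s - r| ≤ η := (lt_of_mul_lt_mul_right hdist hv'.le).le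
  have h1 := hval r hr01 s hs01 hsr
  have h2 := hval s hs01 r hr01 (by rwa [abs_sub_comm])
  rw [abs_lt]
  constructor <;> linarith

end

/-! ## The assumptions of the network -/

section

variable {m N : ℕ} {A E : Type*} [MetricSpace A] [CompactSpace A] [MeasurableSpace A]
  [BorelSpace A]

theorem speed_zero (v : State m) (b : State m → A → State m) (a : A) :
    speed v b 0 a = ⟪b 0 a, v⟫ / ‖v‖ ^ 2 := by
  rw [speed, clamp_of_mem ⟨le_rfl, zero_le_one⟩, zero_smul, coord_apply]

theorem speed_one (v : State m) (b : State m → A → State m) (a : A) :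
    speed v b 1 a = ⟪b v a, v⟫ / ‖v‖ ^ 2 := by
  rw [speed, clamp_of_mem ⟨zero_le_one, le_rfl⟩, one_smul, coord_apply]

theorem exists_isRegular {f : E → State m → A → State m} {l : E → State m → A → ℝ}
    (hf : RegularDynamics f) (hl : RegularCost l) (γ : E) :
    ∃ C K, IsRegular (f γ) (l γ) C K := by
  obtain ⟨hfu, C, hC, hfC⟩ := hf
  obtain ⟨hlu, K, hK, hlK⟩ := hl
  exact ⟨C, K, hC, hK, hfu γ, fun x a => (hfC γ x x a).2, fun x y a => (hfC γ x y a).1,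
    (hlu γ).continuous, fun x y a => (hlK γ x y a).1, fun x a => (hlK γ x x a).2⟩

theorem setting_of_assumptions {e : Fin N → State m} {f : E → State m → A → State m}
    {l : E → State m → A → ℝ} {B : E → Fin N → Set A} {active : Fin N → Set E} (hN : 2 ≤ N)
    (he : ∀ i j, i ≠ j → ¬ SameRay ℝ (e i) (e j)) {γ : E} {C K : ℝ}
    (hr : IsRegular (f γ) (l γ) C K)
    (hB : RoadControls e f B) (hctrl : JunctionControllability e f B active)
    (hcost : InactiveCost l B active) (hroad : RoadValued e f B) :
    Setting e (f γ) (l γ) (B γ) := by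
  have hne : ∀ j, e j ≠ 0 := ne_zero_of_sameRay hN he
  have hsq : ∀ j, 0 < ‖e j‖ ^ 2 := fun j => by
    have := norm_pos_iff.2 (hne j)
    positivity
  obtain ⟨-, hopen, -, hvert, hvertne, hvertor⟩ := hB γ
  -- the scalar velocity at the points of the open road
  have hspeed : ∀ j (r η : ℝ), 0 < η → 0 < r → r ≤ min (1 / 2) (η / ‖e j‖) →
      r • e j ∈ road e j ∧ ‖r • e j‖ ≤ η ∧
        ∀ a, speed (e j) (f γ) r a = ⟪f γ (r • e j) a, e j⟫ / ‖e j‖ ^ 2 := by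
    intro j r η hη h0 hle
    have h1 : r ≤ 1 / 2 := hle.trans (min_le_left _ _)
    refine ⟨⟨r, ⟨h0, by linarith⟩, rfl⟩, ?_, fun a => ?_⟩
    · rw [norm_smul, Real.norm_of_nonneg h0.le]
      exact (le_div_iff₀ (norm_pos_iff.2 (hne j))).1 (hle.trans (min_le_right _ _))
    · rw [speed, clamp_of_mem ⟨h0.le, by linarith⟩, coord_apply]
  have hρ : ∀ j (η : ℝ), 0 < η → 0 < min (1 / 2) (η / ‖e j‖) := fun j η hη =>
    lt_min (by norm_num) (div_pos hη (norm_pos_iff.2 (hne j)))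
  refine ⟨he, hne, ?_, ?_, ?_, ?_, fun j => hroad j γ, ?_, ?_⟩
  · intro j a ha r hr01
    exact tangent hr (hne j) he (fun x hx => by rw [hopen j x hx]; exact ha) hr01
  · intro j
    rw [hvert j]
    exact fun a ha => ha.1
  · intro j
    obtain ⟨a, ha⟩ := hvertne j
    rw [hvert j] at ha
    exact ⟨a, ha.1, by rw [speed_one]; exact div_nonpos_of_nonpos_of_nonneg ha.2 (hsq j).le⟩
  · intro j
    rcases hvertor j with h | ⟨β, hβ, a, ha, hlt⟩
    · refine Or.inl fun a ha => ?_
      rw [← h, hvert j] at ha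
      rw [speed_one]
      exact div_nonpos_of_nonpos_of_nonneg ha.2 (hsq j).le
    · exact Or.inr ⟨a, ha, by rw [speed_one]; exact div_neg_of_neg_of_pos (by linarith) (hsq j)⟩
  · intro j
    by_cases hact : γ ∈ active j
    · obtain ⟨β, hβ, -, -, a, ha, -, hlt⟩ := (hctrl γ j).1 hact
      have hneg : speed (e j) (f γ) 0 a < 0 := by
        rw [speed_zero]; exact div_neg_of_neg_of_pos (by linarith) (hsq j)
      obtain ⟨ρ, hρ, hnear⟩ := hr.exists_speed_near (e j) a (r := 0)
        (s := -speed (e j) (f γ) 0 a / 2) (σ := -1) (by linarith)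
      -- On an active road the inward speed stays bounded away from zero near the intersection by
      -- continuity, which is the case `κ = 0`.
      refine ⟨a, ha, -speed (e j) (f γ) 0 a / 2, by linarith, 0, one_pos, ρ, hρ,
        fun r h0 hrρ => ?_⟩
      have := hnear r (by rwa [sub_zero, abs_of_pos h0])
      rw [Real.rpow_zero]
      linarith
    · obtain ⟨β, η, κ, hβ, hη, -, -, hκ, a, ha, -, -, hback, -, -⟩ := (hctrl γ j).2 hact
      -- The power of `⟪r • e j, e j⟫ = r * ‖e j‖ ^ 2` contributes the numerator, the passage from
      -- inner product to coordinate the denominator.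
      refine ⟨a, ha, β * (‖e j‖ ^ 2) ^ κ / ‖e j‖ ^ 2,
        div_pos (mul_pos hβ (Real.rpow_pos_of_pos (hsq j) _)) (hsq j), κ, hκ, _, hρ j η hη,
        fun r h0 hrρ => ?_⟩
      obtain ⟨h1, h2, h3⟩ := hspeed j r η hη h0 hrρ
      have h4 := hback _ h1 h2
      rw [real_inner_smul_left, real_inner_self_eq_norm_sq, Real.mul_rpow h0.le (hsq j).le] at h4
      rw [h3, div_le_iff₀ (hsq j)]
      refine h4.trans (le_of_eq ?_)
      have := norm_ne_zero_iff.2 (hne j)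
      field_simp
  · intro j
    by_cases hact : γ ∈ active j
    · obtain ⟨β, hβ, a, ha, -, -, hgt, -⟩ := (hctrl γ j).1 hact
      exact Or.inl ⟨a, ha, by rw [speed_zero]; exact div_pos (by linarith) (hsq j)⟩
    · obtain ⟨β, η, κ, hβ, hη, -, -, hκ, -, -, a₀, ha₀, -, hz, hnon⟩ := (hctrl γ j).2 hact
      refine Or.inr ⟨⟨a₀, ha₀, hz⟩, ⟨_, hρ j η hη, fun a ha r h0 hrρ => ?_⟩, hcost γ j hact⟩
      obtain ⟨h1, h2, h3⟩ := hspeed j r η hη h0 hrρ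
      rw [h3]
      exact div_nonpos_of_nonpos_of_nonneg (hnon a ha _ h1 h2) (hsq j).le

end

end TrafficNetwork

theorem mainTheorem6 {m N : ℕ} (hN : 2 ≤ N)
    {A E : Type*} [MetricSpace A] [CompactSpace A] [MeasurableSpace A] [BorelSpace A] [Finite E]
    (e : Fin N → TrafficNetwork.State m)
    (he : ∀ i j, i ≠ j → ¬ SameRay ℝ (e i) (e j))
    (f : E → TrafficNetwork.State m → A → TrafficNetwork.State m)
    (l : E → TrafficNetwork.State m → A → ℝ)
    (B : E → Fin N → Set A) (active : Fin N → Set E)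
    (δ : ℝ) (hδ : 0 < δ)
    (hf : TrafficNetwork.RegularDynamics f)
    (hl : TrafficNetwork.RegularCost l)
    (hB : TrafficNetwork.RoadControls e f B)
    (hctrl : TrafficNetwork.JunctionControllability e f B active)
    (hcost : TrafficNetwork.InactiveCost l B active)
    (hroad : TrafficNetwork.RoadValued e f B) (γ : E) :
    (∀ x ∈ TrafficNetwork.network e,
      IsGLB (TrafficNetwork.costs e (f γ) (l γ) δ x)
        (TrafficNetwork.value e (f γ) (l γ) δ x)) ∧
    (∃ M : ℝ, ∀ x ∈ TrafficNetwork.network e,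
      |TrafficNetwork.value e (f γ) (l γ) δ x| ≤ M) ∧
    UniformContinuousOn (fun x => TrafficNetwork.value e (f γ) (l γ) δ x)
      (TrafficNetwork.network e) := by
  obtain ⟨C, K, hr⟩ := TrafficNetwork.exists_isRegular hf hl γ
  have hs := TrafficNetwork.setting_of_assumptions hN he hr hB hctrl hcost hroad
  refine ⟨fun x hx => ?_, ⟨K / δ, fun x hx =>
    TrafficNetwork.abs_value_le hr hδ (hs.exists_feasible hr x hx)⟩,
    TrafficNetwork.isCompact_network.uniformContinuousOn_of_continuous
      (hs.continuousOn_value hr hδ)⟩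
  obtain ⟨α, y, h⟩ := hs.exists_feasible hr x hx
  exact isGLB_csInf ⟨_, (TrafficNetwork.mem_costs_iff hr).2 ⟨α, y, h, rfl⟩⟩
    (TrafficNetwork.bddBelow_costs hr hδ)
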